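/- Let $n\ge 1$ be finite. Consider algebras $\mathfrak A=\langle A;\cdot,-,s^i_j,s_{ij}\rangle_{i\ne j<n}$ with $\cdot$ binary and the other operations unary; write $a+b=-(-a\cdot -b)$, $0=a\cdot -a$, and $a\le b$ for $a\cdot b=a$. Let $[i|j]:n\to n$ send $i$ to $j$ and fix everything else, and let $[i,j]$ interchange $i$ and $j$. A set $V\subseteq{}^nU$ is *locally square* if $q\circ[i|j]\in V$ and $q\circ[i,j]\in V$ for all $q\in V$ and $i\neq j<n$; then $\wp(V)$ is the algebra of all subsets of $V$ with intersection, complement relative to $V$, $S^i_jX=\{q\in V:q\circ[i|j]\in X\}$ and $S_{ij}X=\{q\in V:q\circ[i,j]\in X\}$. Let $\Sigma_n$ be the finite set of equations consisting of the Boolean axioms, equations saying that every $s^i_j$ and $s_{ij}$ is a Boolean endomorphism, and the following equations for distinct $i,j,k,l<n$: $s_{ij}x=s_{ji}x$; $s_{ij}s_{ij}x=x$; $s_{ij}s_{ik}s_{ij}x=s_{jk}x$; $s_{ij}s_{kl}x=s_{kl}s_{ij}x$; $s_{kl}s^j_is_{kl}x=s^j_ix$; $s_{jk}s^j_is_{jk}x=s^k_ix$;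 $s_{ki}s^j_is_{ki}x=s^j_kx$; $s_{ij}s^j_is_{ij}x=s^i_jx$; $s^j_is^k_lx=s^k_ls^j_ix$; $s^j_is^k_ix=s^k_is^j_ix=s^j_is^k_jx$; $s^j_is^i_kx=s^j_ks_{ij}x$; $s^j_is^j_kx=s^j_kx$; $s^j_is^j_ix=s^j_ix$; $s^j_is^i_jx=s^j_ix$; $s^j_is_{ij}x=s^j_ix$. Let $SA_n$ be the class of models of $\Sigma_n$, and let $CSA_n$ be the class of *completely representable* algebras in $SA_n$, i.e. those $\mathfrak A\in SA_n$ for which there are a locally square set $V$ and an injective homomorphism $f:\mathfrak A\to\wp(V)$ such that $f(\prod X)=\bigcap_{x\in X}f(x)$ whenever $X\subseteq A$ has a meet $\prod X$ in $\mathfrak A$. Let $\mathrm{At}(x)$ be the formula $x\ne0\wedge\forall y\,(y\le x\to y=0\vee y=x)$, and for distinct $i,j<n$ let $\psi_{i,j}$ be the sentence $\forall y\,\bigl(y\ne0\to\exists x\,(\mathrm{At}(x)\wedge s^i_jx\cdot y\ne0)\bigr)$. **Theorem.** The class $CSA_n$ is elementary and finitely axiomatizable in first-order logic: it is exactly the class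 of models of the finite set of sentences $\Sigma_n\cup\{\forall y\,(y\neq0\to\exists x\,(\mathrm{At}(x)\wedge x\le y))\}\cup\{\psi_{i,j}:i\ne j<n\}$. Thus an atomic algebra in $SA_n$ is completely representable if it satisfies all $\psi_{i,j}$, and conversely every completely representable algebra in $SA_n$ is atomic and satisfies all $\psi_{i,j}$. Moreover, for an atomic $\mathfrak A\in SA_n$ and distinct $i,j<n$, $\mathfrak A\models\psi_{i,j}$ if and only if $s^i_j$ is completely additive in $\mathfrak A$, i.e. preserves every join that exists in $\mathfrak A$. -/

import Mathlib

namespace SubstAlg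

open FirstOrder FirstOrder.Language

universe u

/-! ### The similarity type -/

/-- Operation symbols in dimension `n`: Boolean meet and complement, and, for distinct `i j < n`,
the replacement `repl i j` (written `s^i_j`, it belongs to the map `[i|j]` sending `i` to `j` and
fixing everything else) and the transposition `swap i j` (written `s_{ij}`, it belongs to the map
`[i,j]` interchanging `i` and `j`). -/
inductive Op (n : ℕ) : ℕ → Type
  | meet : Op n 2
  | compl : Op n 1
  | repl (i j : Fin n) (h : i ≠ j) : Op n 1
  | swap (i j : Fin n) (h : i ≠ j) : Op n 1

/-- The first-order language of substitution algebras with transpositions of dimension `n`;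
it has no relation symbols. -/
abbrev lang (n : ℕ) : FirstOrder.Language.{0, 0} where
  Functions := Op n
  Relations := fun _ => Empty

/-! ### Concrete set algebras -/

/-- The map `[i|j]`: it sends `i` to `j` and fixes everything else. -/
def replMap {n : ℕ} (i j : Fin n) : Fin n → Fin n := Function.update id i j

/-- `V ⊆ ⁿU` is locally square: closed under composition on the right with all `[i|j]` and
`[i,j]`, `i ≠ j`. -/
def LocallySquare {n : ℕ} {U : Type u} (V : Set (Fin n → U)) : Prop :=
  ∀ i j : Fin n, i ≠ j → ∀ q ∈ V, q ∘ replMap i j ∈ V ∧ q ∘ Equiv.swap i j ∈ V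

/-- The substitution operation on subsets of `V` given by `τ`: `X ↦ {q ∈ V : q ∘ τ ∈ X}`. -/
def setSubst {n : ℕ} {U : Type u} (V : Set (Fin n → U)) (τ : Fin n → Fin n) (X : Set V) : Set V :=
  {q | ∃ p ∈ X, (p : Fin n → U) = (q : Fin n → U) ∘ τ}

/-- The set algebra `℘(V)`: intersection, complement relative to `V`, and the substitutions. -/
instance setAlgebra {n : ℕ} {U : Type u} (V : Set (Fin n → U)) : (lang n).Structure (Set V) where
  funMap {_} f := match f with
    | .meet => fun x => x 0 ∩ x 1
    | .compl => fun x => (x 0)ᶜ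
    | .repl i j _ => fun x => setSubst V (replMap i j) (x 0)
    | .swap i j _ => fun x => setSubst V (Equiv.swap i j) (x 0)
  RelMap {_} r := r.elim

/-! ### Abstract algebras: operations and order -/

/-- The Boolean order: `x ≤ y` iff `x · y = x`. -/
def Le (n : ℕ) {M : Type u} [(lang n).Structure M] (x y : M) : Prop :=
  Structure.funMap (L := lang n) Op.meet ![x, y] = x

/-- `m` is the meet (greatest lower bound) of `X`. -/
def IsMeet (n : ℕ) {M : Type u} [(lang n).Structure M] (X : Set M) (m : M) : Prop :=
  (∀ x ∈ X, Le n m x) ∧ ∀ z, (∀ x ∈ X, Le n z x) → Le n z m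

/-- `m` is the join (least upper bound) of `X`. -/
def IsJoin (n : ℕ) {M : Type u} [(lang n).Structure M] (X : Set M) (m : M) : Prop :=
  (∀ x ∈ X, Le n x m) ∧ ∀ z, (∀ x ∈ X, Le n x z) → Le n m z

/-- The unary operation `s` preserves all joins that exist in the algebra. -/
def CompletelyAdditive (n : ℕ) {M : Type u} [(lang n).Structure M] (s : M → M) : Prop :=
  ∀ (X : Set M) (m : M), IsJoin n X m → IsJoin n (s '' X) (s m)

/-- The replacement operation `s^i_j` of an algebra. -/
def replOp {n : ℕ} (M : Type u) [(lang n).Structure M] (i j : Fin n) (h : i ≠ j) (x : M) : M :=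
  Structure.funMap (L := lang n) (Op.repl i j h) ![x]

/-! ### Terms and formulas -/

section Formulas

variable {n : ℕ} {α : Type}

def tMeet (t u : (lang n).Term α) : (lang n).Term α :=
  Functions.apply₂ (L := lang n) Op.meet t u

def tCompl (t : (lang n).Term α) : (lang n).Term α :=
  Functions.apply₁ (L := lang n) Op.compl t

/-- `t + u` abbreviates `-(-t · -u)`. -/
def tJoin (t u : (lang n).Term α) : (lang n).Term α :=
  tCompl (tMeet (tCompl t) (tCompl u))

/-- `s^i_j t` -/
def tRepl (i j : Fin n) (h : i ≠ j) (t : (lang n).Term α) : (lang n).Term α :=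
  Functions.apply₁ (L := lang n) (Op.repl i j h) t

/-- `s_{ij} t` -/
def tSwap (i j : Fin n) (h : i ≠ j) (t : (lang n).Term α) : (lang n).Term α :=
  Functions.apply₁ (L := lang n) (Op.swap i j h) t

/-- The bound variable number `i`. -/
def var {k : ℕ} (i : Fin k) : (lang n).Term (Empty ⊕ Fin k) := Term.var (Sum.inr i)

/-- The variables of the equations. -/
def x : (lang n).Term (Empty ⊕ Fin 3) := var 0
def y : (lang n).Term (Empty ⊕ Fin 3) := var 1
def z : (lang n).Term (Empty ⊕ Fin 3) := var 2

/-- The universal closure of the equation `t = u` in the variables `x, y, z`. -/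
def eqn (t u : (lang n).Term (Empty ⊕ Fin 3)) : (lang n).Sentence :=
  (t.bdEqual u).alls

/-- `t = 0`, expressed as `t = t · -t`. -/
def isZero {k : ℕ} (t : (lang n).Term (Empty ⊕ Fin k)) : (lang n).BoundedFormula Empty k :=
  t.bdEqual (tMeet t (tCompl t))

/-- `t ≤ u`, expressed as `t · u = t`. -/
def le {k : ℕ} (t u : (lang n).Term (Empty ⊕ Fin k)) : (lang n).BoundedFormula Empty k :=
  (tMeet t u).bdEqual t

/-- `At(v₁)`: the variable number 1 is an atom, i.e. `v₁ ≠ 0 ∧ ∀ v₂ (v₂ ≤ v₁ → v₂ = 0 ∨ v₂ = v₁)`. -/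
def atF : (lang n).BoundedFormula Empty 2 :=
  (isZero (var 1)).not ⊓
    ((le (k := 3) (var 2) (var 1)).imp (isZero (var 2) ⊔ (var 2).bdEqual (var 1))).all

/-- Atomicity: `∀ v₀ (v₀ ≠ 0 → ∃ v₁ (At(v₁) ∧ v₁ ≤ v₀))`. -/
def atomicity : (lang n).Sentence :=
  ((isZero (k := 1) (var 0)).not.imp (atF ⊓ le (var 1) (var 0)).ex).all

/-- The sentence `∀ v₀ (v₀ ≠ 0 → ∃ v₁ (At(v₁) ∧ s^i_j v₁ · v₀ ≠ 0))`. -/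
def psi (i j : Fin n) (h : i ≠ j) : (lang n).Sentence :=
  ((isZero (k := 1) (var 0)).not.imp
    (atF ⊓ (isZero (tMeet (tRepl i j h (var 1)) (var 0))).not).ex).all

end Formulas

/-! ### The equations -/

/-- The equations `Σ_n`: the Boolean axioms in meet and complement; all substitutions are Boolean
endomorphisms; and a presentation of the monoid of all self-maps of `n` in terms of transpositions
and replacements. Different letters `i, j, k, l` stand for distinct indices. -/
inductive SAEq (n : ℕ) : (lang n).Sentence → Prop
  -- Boolean axioms
  | meet_comm : SAEq n (eqn (tMeet x y) (tMeet y x))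
  | meet_assoc : SAEq n (eqn (tMeet (tMeet x y) z) (tMeet x (tMeet y z)))
  | join_comm : SAEq n (eqn (tJoin x y) (tJoin y x))
  | join_assoc : SAEq n (eqn (tJoin (tJoin x y) z) (tJoin x (tJoin y z)))
  | absorb_meet : SAEq n (eqn (tMeet x (tJoin x y)) x)
  | absorb_join : SAEq n (eqn (tJoin x (tMeet x y)) x)
  | distrib : SAEq n (eqn (tMeet x (tJoin y z)) (tJoin (tMeet x y) (tMeet x z)))
  | zero_le : SAEq n (eqn (tMeet (tMeet x (tCompl x)) y) (tMeet x (tCompl x)))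
  | le_one : SAEq n (eqn (tMeet (tJoin x (tCompl x)) y) y)
  -- the substitutions are Boolean endomorphisms
  | swap_meet (i j : Fin n) (h : i ≠ j) :
      SAEq n (eqn (tSwap i j h (tMeet x y)) (tMeet (tSwap i j h x) (tSwap i j h y)))
  | swap_compl (i j : Fin n) (h : i ≠ j) :
      SAEq n (eqn (tSwap i j h (tCompl x)) (tCompl (tSwap i j h x)))
  | repl_meet (i j : Fin n) (h : i ≠ j) :
      SAEq n (eqn (tRepl i j h (tMeet x y)) (tMeet (tRepl i j h x) (tRepl i j h y)))
  | repl_compl (i j : Fin n) (h : i ≠ j) :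
      SAEq n (eqn (tRepl i j h (tCompl x)) (tCompl (tRepl i j h x)))
  -- relations among the transpositions
  | swap_symm (i j : Fin n) (h : i ≠ j) : SAEq n (eqn (tSwap i j h x) (tSwap j i h.symm x))
  | swap_invol (i j : Fin n) (h : i ≠ j) : SAEq n (eqn (tSwap i j h (tSwap i j h x)) x)
  | swap_conj (i j k : Fin n) (hij : i ≠ j) (hik : i ≠ k) (hjk : j ≠ k) :
      SAEq n (eqn (tSwap i j hij (tSwap i k hik (tSwap i j hij x))) (tSwap j k hjk x))
  | swap_swap (i j k l : Fin n) (hij : i ≠ j) (_ : i ≠ k) (_ : i ≠ l) (_ : j ≠ k) (_ : j ≠ l)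
      (hkl : k ≠ l) :
      SAEq n (eqn (tSwap i j hij (tSwap k l hkl x)) (tSwap k l hkl (tSwap i j hij x)))
  -- conjugating replacements by transpositions
  | conj_disjoint (i j k l : Fin n) (hij : i ≠ j) (_ : i ≠ k) (_ : i ≠ l) (_ : j ≠ k) (_ : j ≠ l)
      (hkl : k ≠ l) :
      SAEq n (eqn (tSwap k l hkl (tRepl j i hij.symm (tSwap k l hkl x))) (tRepl j i hij.symm x))
  | conj_source (i j k : Fin n) (hij : i ≠ j) (hik : i ≠ k) (hjk : j ≠ k) :
      SAEq n (eqn (tSwap j k hjk (tRepl j i hij.symm (tSwap j k hjk x))) (tRepl k i hik.symm x))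
  | conj_target (i j k : Fin n) (hij : i ≠ j) (hik : i ≠ k) (hjk : j ≠ k) :
      SAEq n (eqn (tSwap k i hik.symm (tRepl j i hij.symm (tSwap k i hik.symm x)))
        (tRepl j k hjk x))
  | conj_self (i j : Fin n) (hij : i ≠ j) :
      SAEq n (eqn (tSwap i j hij (tRepl j i hij.symm (tSwap i j hij x))) (tRepl i j hij x))
  -- products of replacements
  | repl_disjoint (i j k l : Fin n) (hij : i ≠ j) (_ : i ≠ k) (_ : i ≠ l) (_ : j ≠ k) (_ : j ≠ l)
      (hkl : k ≠ l) :
      SAEq n (eqn (tRepl j i hij.symm (tRepl k l hkl x)) (tRepl k l hkl (tRepl j i hij.symm x)))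
  | repl_same_target (i j k : Fin n) (hij : i ≠ j) (hik : i ≠ k) (_ : j ≠ k) :
      SAEq n (eqn (tRepl j i hij.symm (tRepl k i hik.symm x))
        (tRepl k i hik.symm (tRepl j i hij.symm x)))
  | repl_chain (i j k : Fin n) (hij : i ≠ j) (hik : i ≠ k) (hjk : j ≠ k) :
      SAEq n (eqn (tRepl j i hij.symm (tRepl k i hik.symm x))
        (tRepl j i hij.symm (tRepl k j hjk.symm x)))
  | repl_shift (i j k : Fin n) (hij : i ≠ j) (hik : i ≠ k) (hjk : j ≠ k) :
      SAEq n (eqn (tRepl j i hij.symm (tRepl i k hik x)) (tRepl j k hjk (tSwap i j hij x)))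
  | repl_same_source (i j k : Fin n) (hij : i ≠ j) (_ : i ≠ k) (hjk : j ≠ k) :
      SAEq n (eqn (tRepl j i hij.symm (tRepl j k hjk x)) (tRepl j k hjk x))
  | repl_idem (i j : Fin n) (hij : i ≠ j) :
      SAEq n (eqn (tRepl j i hij.symm (tRepl j i hij.symm x)) (tRepl j i hij.symm x))
  | repl_back (i j : Fin n) (hij : i ≠ j) :
      SAEq n (eqn (tRepl j i hij.symm (tRepl i j hij x)) (tRepl j i hij.symm x))
  | repl_swap (i j : Fin n) (hij : i ≠ j) :
      SAEq n (eqn (tRepl j i hij.symm (tSwap i j hij x)) (tRepl j i hij.symm x))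

/-- The theory `Σ_n`; its (nonempty) models form the variety `SA_n`. -/
def saTheory (n : ℕ) : (lang n).Theory := {φ | SAEq n φ}

/-- `Σ_n` together with atomicity and the sentences `ψ_{i,j}` for distinct `i, j < n`. -/
def csaTheory (n : ℕ) : (lang n).Theory :=
  saTheory n ∪ {atomicity} ∪ {φ | ∃ (i j : Fin n) (h : i ≠ j), φ = psi i j h}

/-! ### Complete representability -/

/-- A complete representation on `V`: an embedding into `℘(V)` carrying every meet that exists
in the algebra to the intersection. -/
def IsCompleteRep {n : ℕ} {M : Type u} [(lang n).Structure M] {U : Type u} (V : Set (Fin n → U))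
    (f : M ↪[lang n] Set V) : Prop :=
  ∀ (X : Set M) (m : M), IsMeet n X m → f m = ⋂ a ∈ X, f a

/-- Membership in `CSA_n`: an algebra of `SA_n` with a complete representation on some
locally square set. -/
def IsCSA (n : ℕ) (M : Type u) [(lang n).Structure M] : Prop :=
  M ⊨ saTheory n ∧
    ∃ (U : Type u) (V : Set (Fin n → U)), LocallySquare V ∧
      ∃ f : M ↪[lang n] Set V, IsCompleteRep V f

end SubstAlg

namespace SubstAlg

open FirstOrder FirstOrder.Language

universe u

/-! ### The presentation of the monoid of self-maps -/

/-! Necessity. In a complete representation `f`, the elements whose image contains a fixed point `q`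
form an ultrafilter. Its meet cannot be `0`, since `q` would then lie in `f 0 = ∅`; hence it has a
nonzero lower bound, and this is an atom whose image contains `q` (`exists_isAtom_mem`). For `q` in
the image of `y` that atom lies below `y`, which gives atomicity. Applied to `q ∘ [i|j]`, which
local squareness keeps in `V`, it gives an atom `a` with `q` in the image of `s^i_j a · y`, which is
`ψ_{i,j}`.

Sufficiency. The relations of `Σ_n` present the monoid generated by the maps `[i,j]` and `[i|j]`:
words with the same map define the same operation. So every generated map `τ` has a well-defined
operation `s_τ`, with `s_τ s_σ = s_{τσ}`. Take one disjoint copy of these maps for each atom `a`,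
and put the point `(a, τ)` into the image of `y` iff `a ≤ s_τ y`. Multiplicativity gives the
substitutions; that `a` is an atom and `s_τ` a Boolean endomorphism gives meet and complement;
atomicity, used at `τ = 1`, gives injectivity. Completeness needs each `s_τ` to preserve existing
meets: transpositions do because they are involutions, replacements because `ψ_{i,j}` makes the
images of atoms dense (`IsBoolHom.isLUB_image`).

The presentation result is `SubstRel.injOn_closure`. Every word is a permutation word times a
canonical retraction onto least representatives (`exists_normalForm`). The retraction depends only
on the kernel of the map (`IsRetraction.eq_of_ker`), and permutations fixing its range are absorbed
by it (`mul_eq_of_fixes`). Applied in the product of the monoid of self-maps with the monoid of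
operations, projected to the first factor, this says that the map determines the operation. -/

/-- Elements `s i j` and `r i j` of a monoid satisfying the defining relations between the
transpositions `[i,j]` and the replacements `[i|j]`, with the convention `s i i = r i i = 1`. -/
structure SubstRel {α N : Type*} [Monoid N] (s r : α → α → N) : Prop where
  s_self : ∀ i, s i i = 1
  r_self : ∀ i, r i i = 1
  s_symm : ∀ i j, i ≠ j → s i j = s j i
  s_invol : ∀ i j, i ≠ j → s i j * s i j = 1
  s_conj : ∀ i j k, i ≠ j → i ≠ k → j ≠ k → s i j * (s i k * s i j) = s j k
  s_comm : ∀ i j k l, i ≠ j → i ≠ k → i ≠ l → j ≠ k → j ≠ l → k ≠ l →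
    s i j * s k l = s k l * s i j
  conj_disjoint : ∀ i j k l, i ≠ j → i ≠ k → i ≠ l → j ≠ k → j ≠ l → k ≠ l →
    s k l * (r j i * s k l) = r j i
  conj_source : ∀ i j k, i ≠ j → i ≠ k → j ≠ k → s j k * (r j i * s j k) = r k i
  conj_target : ∀ i j k, i ≠ j → i ≠ k → j ≠ k → s k i * (r j i * s k i) = r j k
  conj_self : ∀ i j, i ≠ j → s i j * (r j i * s i j) = r i j
  r_disjoint : ∀ i j k l, i ≠ j → i ≠ k → i ≠ l → j ≠ k → j ≠ l → k ≠ l →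
    r j i * r k l = r k l * r j i
  r_same_target : ∀ i j k, i ≠ j → i ≠ k → j ≠ k → r j i * r k i = r k i * r j i
  r_chain : ∀ i j k, i ≠ j → i ≠ k → j ≠ k → r j i * r k i = r j i * r k j
  r_shift : ∀ i j k, i ≠ j → i ≠ k → j ≠ k → r j i * r i k = r j k * s i j
  r_same_source : ∀ i j k, i ≠ j → i ≠ k → j ≠ k → r j i * r j k = r j k
  r_idem : ∀ i j, i ≠ j → r j i * r j i = r j i
  r_back : ∀ i j, i ≠ j → r j i * r i j = r j i
  r_swap : ∀ i j, i ≠ j → r j i * s i j = r j i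

namespace SubstRel

/-- The submonoid generated by the `s k l` with `k` and `l` in `F`. -/
abbrev swapMonoid {α N : Type*} [Monoid N] (s : α → α → N) (F : Set α) : Submonoid N :=
  Submonoid.closure {m | ∃ k ∈ F, ∃ l ∈ F, m = s k l}

/-! ### Pairing two systems that satisfy the relations. -/

section Prod

variable {α N N' : Type*} [Monoid N] [Monoid N'] {s r : α → α → N} {s' r' : α → α → N'}

/-- Used to pair each self-map with its operation, so that the first projection can serve as `φ` in
`injOn_closure`. -/
theorem prod (h : SubstRel s r) (h' : SubstRel s' r') :
    SubstRel (fun i j => (s i j, s' i j)) (fun i j => (r i j, r' i j)) where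
  s_self i := Prod.ext (h.s_self i) (h'.s_self i)
  r_self i := Prod.ext (h.r_self i) (h'.r_self i)
  s_symm i j a := Prod.ext (h.s_symm i j a) (h'.s_symm i j a)
  s_invol i j a := Prod.ext (h.s_invol i j a) (h'.s_invol i j a)
  s_conj i j k a b c := Prod.ext (h.s_conj i j k a b c) (h'.s_conj i j k a b c)
  s_comm i j k l a b c d e f := Prod.ext (h.s_comm i j k l a b c d e f)
    (h'.s_comm i j k l a b c d e f)
  conj_disjoint i j k l a b c d e f := Prod.ext (h.conj_disjoint i j k l a b c d e f)
    (h'.conj_disjoint i j k l a b c d e f)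
  conj_source i j k a b c := Prod.ext (h.conj_source i j k a b c) (h'.conj_source i j k a b c)
  conj_target i j k a b c := Prod.ext (h.conj_target i j k a b c) (h'.conj_target i j k a b c)
  conj_self i j a := Prod.ext (h.conj_self i j a) (h'.conj_self i j a)
  r_disjoint i j k l a b c d e f := Prod.ext (h.r_disjoint i j k l a b c d e f)
    (h'.r_disjoint i j k l a b c d e f)
  r_same_target i j k a b c := Prod.ext (h.r_same_target i j k a b c)
    (h'.r_same_target i j k a b c)
  r_chain i j k a b c := Prod.ext (h.r_chain i j k a b c) (h'.r_chain i j k a b c)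
  r_shift i j k a b c := Prod.ext (h.r_shift i j k a b c) (h'.r_shift i j k a b c)
  r_same_source i j k a b c := Prod.ext (h.r_same_source i j k a b c)
    (h'.r_same_source i j k a b c)
  r_idem i j a := Prod.ext (h.r_idem i j a) (h'.r_idem i j a)
  r_back i j a := Prod.ext (h.r_back i j a) (h'.r_back i j a)
  r_swap i j a := Prod.ext (h.r_swap i j a) (h'.r_swap i j a)

end Prod

/-! ### The self-maps satisfy the relations. -/

/-- The transposition `[i,j]` as an element of the monoid of self-maps. -/
def swapEnd {α : Type*} [DecidableEq α] (i j : α) : Function.End α := ⇑(Equiv.swap i j)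

/-- The replacement `[i|j]` as an element of the monoid of self-maps. -/
def replEnd {α : Type*} [DecidableEq α] (i j : α) : Function.End α := Function.update id i j

theorem swapEnd_apply {α : Type*} [DecidableEq α] (i j x : α) :
    swapEnd i j x = if x = i then j else if x = j then i else x := Equiv.swap_apply_def i j x

theorem replEnd_apply {α : Type*} [DecidableEq α] (i j x : α) :
    replEnd i j x = if x = i then j else x := by
  simp [replEnd, Function.update_apply]

theorem mul_apply {α : Type*} (f g : Function.End α) (x : α) : (f * g) x = f (g x) := rfl

theorem one_apply {α : Type*} (x : α) : (1 : Function.End α) x = x := rfl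

theorem selfMaps (α : Type*) [DecidableEq α] :
    SubstRel (swapEnd : α → α → Function.End α) replEnd := by
  constructor <;> intros <;> funext x <;>
    simp only [mul_apply, one_apply, swapEnd_apply, replEnd_apply] <;> grind

/-! ### Consequences of the relations. -/

section Relations

variable {α N : Type*} [DecidableEq α] [Monoid N] {s r : α → α → N} (h : SubstRel s r)
include h

theorem symm (i j : α) : s i j = s j i := by
  by_cases hij : i = j
  · rw [hij]
  · exact h.s_symm i j hij

theorem invol (i j : α) : s i j * s i j = 1 := by
  by_cases hij : i = j
  · rw [hij, h.s_self, one_mul]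
  · exact h.s_invol i j hij

theorem swap_mul_cancel (i j : α) (m : N) : s i j * (s i j * m) = m := by
  rw [← mul_assoc, h.invol, one_mul]

/-- Collects the four conjugation relations, one for each way `{k, l}` can meet `{i, j}`, together
with the degenerate cases. -/
theorem conj (k l i j : α) :
    s k l * (r i j * s k l) = r (Equiv.swap k l i) (Equiv.swap k l j) := by
  by_cases hkl : k = l
  · subst hkl
    simp [h.s_self]
  by_cases hij : i = j
  · subst hij
    simp [h.r_self, h.invol]
  by_cases hki : k = i
  · subst hki
    by_cases hlj : l = j
    · subst hlj
      rw [Equiv.swap_apply_left, Equiv.swap_apply_right, h.symm, h.conj_self _ _ (Ne.symm hkl)]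
    · rw [Equiv.swap_apply_left, Equiv.swap_apply_of_ne_of_ne (Ne.symm hij) (Ne.symm hlj),
        h.conj_source j k l (Ne.symm hij) (Ne.symm hlj) hkl]
  by_cases hli : l = i
  · subst hli
    by_cases hkj : k = j
    · subst hkj
      rw [Equiv.swap_apply_left, Equiv.swap_apply_right, h.conj_self _ _ hkl]
    · rw [Equiv.swap_apply_right, Equiv.swap_apply_of_ne_of_ne (Ne.symm hkj) (Ne.symm hij),
        h.symm, h.conj_source j l k (Ne.symm hij) (Ne.symm hkj) (Ne.symm hkl)]
  rw [Equiv.swap_apply_of_ne_of_ne (Ne.symm hki) (Ne.symm hli)]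
  by_cases hkj : k = j
  · subst hkj
    rw [Equiv.swap_apply_left, h.symm, h.conj_target k i l (Ne.symm hij) hkl (Ne.symm hli)]
  by_cases hlj : l = j
  · subst hlj
    rw [Equiv.swap_apply_right, h.conj_target l i k (Ne.symm hij) (Ne.symm hkl) (Ne.symm hki)]
  rw [Equiv.swap_apply_of_ne_of_ne (Ne.symm hkj) (Ne.symm hlj),
    h.conj_disjoint j i k l (Ne.symm hij) (Ne.symm hkj) (Ne.symm hlj) (Ne.symm hki)
      (Ne.symm hli) hkl]

theorem swap_mul_repl (k l i j : α) :
    s k l * r i j = r (Equiv.swap k l i) (Equiv.swap k l j) * s k l := by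
  rw [← h.conj, mul_assoc, mul_assoc, h.invol, mul_one]

/-- Replacements with different sources which are not targets of each other commute. -/
theorem repl_comm {i j k l : α} (hik : i ≠ k) (hil : i ≠ l) (hkj : k ≠ j) :
    r i j * r k l = r k l * r i j := by
  by_cases hij : i = j
  · rw [hij, h.r_self, one_mul, mul_one]
  by_cases hkl : k = l
  · rw [hkl, h.r_self, one_mul, mul_one]
  by_cases hjl : j = l
  · subst hjl
    exact h.r_same_target j i k (Ne.symm hij) hkj.symm hik
  · exact h.r_disjoint j i k l (Ne.symm hij) hkj.symm hjl hik hil hkl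

theorem repl_mul_repl {i j k : α} (hij : i ≠ j) (hik : i ≠ k) : r i j * r i k = r i k := by
  by_cases hjk : j = k
  · subst hjk
    exact h.r_idem j i hij.symm
  · exact h.r_same_source j i k hij.symm hjk hik

omit [DecidableEq α] in
theorem repl_eq_swap_mul {i j : α} (hij : i ≠ j) : r i j = s i j * r j i := by
  rw [← h.conj_self i j hij, h.r_swap i j hij]

/-- A transposition of two points that have been replaced by other points has no effect. -/
theorem swap_mul_repl_mul_repl {k l a b : α} (hkl : k ≠ l) (hka : k ≠ a) (hkb : k ≠ b)
    (hla : l ≠ a) (hlb : l ≠ b) : s k l * (r k a * r l b) = r k a * r l b := by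
  have h1 : s k l * (r k a * r l b) = r l a * (r k b * s k l) := by
    rw [← mul_assoc, h.swap_mul_repl, Equiv.swap_apply_left,
      Equiv.swap_apply_of_ne_of_ne hka.symm hla.symm, mul_assoc, h.swap_mul_repl,
      Equiv.swap_apply_right, Equiv.swap_apply_of_ne_of_ne hkb.symm hlb.symm]
  have h2 : r k b * s k l = r k l * r l b := by
    rw [h.symm, h.r_shift l k b hkl.symm hlb hkb]
  have h3 : r l a * r k l = r k a * r l a := by
    rw [← h.r_chain a l k hla.symm hka.symm hkl.symm,
      h.r_same_target a l k hla.symm hka.symm hkl.symm]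
  rw [h1, h2, ← mul_assoc, h3, mul_assoc, h.repl_mul_repl hla hlb]

/-! ### Products of transpositions -/

/-- Coset enumeration for symmetric groups: the elements `s a q` represent the left cosets of the
words over `F` among the words over `insert a F`, and left multiplication by a generator carries
representatives to representatives. -/
theorem exists_swap_mul_swap {F : Set α} {a i j p : α} (ha : a ∉ F) (hi : i ∈ insert a F)
    (hj : j ∈ insert a F) (hp : p ∈ insert a F) :
    ∃ q ∈ insert a F, ∃ t ∈ swapMonoid s F,
      s i j * s a p = s a q * t := by
  have key : ∀ b ∈ F, ∃ q ∈ insert a F, ∃ t ∈ swapMonoid s F,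
      s a b * s a p = s a q * t := by
    intro b hb
    have hab : a ≠ b := fun e => ha (e ▸ hb)
    rcases hp with rfl | hp
    · exact ⟨b, Or.inr hb, 1, one_mem _, by rw [h.s_self]⟩
    by_cases hpb : p = b
    · subst hpb
      exact ⟨a, Or.inl rfl, 1, one_mem _, by rw [h.invol, h.s_self, one_mul]⟩
    · have hap : a ≠ p := fun e => ha (e ▸ hp)
      refine ⟨p, Or.inr hp, s p b, Submonoid.subset_closure ⟨p, hp, b, hb, rfl⟩, ?_⟩
      rw [← h.s_conj a p b hap hab hpb, h.swap_mul_cancel]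
  by_cases hij : i = j
  · exact ⟨p, hp, 1, one_mem _, by rw [hij, h.s_self, one_mul, mul_one]⟩
  rcases hi with rfl | hi
  · exact key j (hj.resolve_left (Ne.symm hij))
  rcases hj with rfl | hj
  · rw [h.symm]
    exact key i hi
  have haj : a ≠ j := fun e => ha (e ▸ hj)
  have hai : a ≠ i := fun e => ha (e ▸ hi)
  have hs : s i j ∈ swapMonoid s F :=
    Submonoid.subset_closure ⟨i, hi, j, hj, rfl⟩
  rcases hp with rfl | hp
  · exact ⟨p, Or.inl rfl, s i j, hs, by rw [h.s_self, one_mul, mul_one]⟩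
  by_cases hpi : p = i
  · subst hpi
    refine ⟨j, Or.inr hj, s p j, hs, ?_⟩
    rw [h.symm a j, ← h.s_conj p j a hij hai.symm haj.symm, mul_assoc, mul_assoc, h.invol,
      mul_one, h.symm a p]
  by_cases hpj : p = j
  · subst hpj
    refine ⟨i, Or.inr hi, s i p, hs, ?_⟩
    rw [h.symm a i, h.symm i p, ← h.s_conj p i a hpi haj.symm hai.symm, mul_assoc, mul_assoc,
      h.invol, mul_one, h.symm a p]
  · have hap : a ≠ p := fun e => ha (e ▸ hp)
    exact ⟨p, Or.inr hp, s i j, hs,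
      h.s_comm i j a p hij hai.symm (Ne.symm hpi) haj.symm (Ne.symm hpj) hap⟩

theorem exists_eq_swap_mul {F : Set α} {a : α} (ha : a ∉ F) {m : N}
    (hm : m ∈ swapMonoid s (insert a F)) :
    ∃ q ∈ insert a F, ∃ t ∈ swapMonoid s F,
      m = s a q * t := by
  induction hm using Submonoid.closure_induction_left with
  | one => exact ⟨a, Or.inl rfl, 1, one_mem _, by rw [h.s_self, one_mul]⟩
  | mul_left g hg m hm ih =>
    obtain ⟨i, hi, j, hj, rfl⟩ := hg
    obtain ⟨p, hp, t, ht, rfl⟩ := ih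
    obtain ⟨q, hq, t', ht', e⟩ := h.exists_swap_mul_swap ha hi hj hp
    exact ⟨q, hq, t' * t, mul_mem ht' ht, by rw [← mul_assoc, e, mul_assoc]⟩

/-- `N` is only a monoid; the generators are involutions, so reversing a word inverts it. -/
theorem exists_inverse {F : Set α} {m : N}
    (hm : m ∈ swapMonoid s F) :
    ∃ m' ∈ swapMonoid s F, m * m' = 1 ∧ m' * m = 1 := by
  induction hm using Submonoid.closure_induction_left with
  | one => exact ⟨1, one_mem _, one_mul 1, one_mul 1⟩
  | mul_left g hg m hm ih =>
    obtain ⟨m', hm', h1, h2⟩ := ih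
    have hg' := hg
    obtain ⟨i, hi, j, hj, rfl⟩ := hg
    refine ⟨m' * s i j, mul_mem hm' (Submonoid.subset_closure hg'), ?_, ?_⟩
    · rw [mul_assoc, ← mul_assoc m, h1, one_mul, h.invol]
    · rw [mul_assoc, h.swap_mul_cancel, h2]

variable {φ : N →* Function.End α} (hs : ∀ i j, φ (s i j) = swapEnd i j)
include hs

omit h in
theorem map_apply_of_notMem {F : Set α} {m : N}
    (hm : m ∈ swapMonoid s F) {x : α} (hx : x ∉ F) :
    φ m x = x := by
  induction hm using Submonoid.closure_induction_left with
  | one => rw [map_one, one_apply]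
  | mul_left g hg m hm ih =>
    obtain ⟨i, hi, j, hj, rfl⟩ := hg
    rw [map_mul, mul_apply, ih, hs]
    exact Equiv.swap_apply_of_ne_of_ne (fun e => hx (e ▸ hi)) (fun e => hx (e ▸ hj))

/-- A product of transpositions that fixes a set pointwise is a product of transpositions of
points outside this set. -/
theorem mem_closure_of_fixes {F : Set α} (C : Finset α) {m : N}
    (hm : m ∈ swapMonoid s (F ∪ C))
    (hC : ∀ x ∈ C, φ m x = x) :
    m ∈ swapMonoid s F := by
  induction C using Finset.induction_on with
  | empty => simpa using hm
  | insert a C haC ih =>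
    rw [Finset.coe_insert, Set.union_insert] at hm
    refine ih ?_ (fun x hx => hC x (Finset.mem_insert_of_mem hx))
    by_cases haF : a ∈ F ∪ C
    · rwa [Set.insert_eq_of_mem haF] at hm
    obtain ⟨q, hq, t, ht, rfl⟩ := h.exists_eq_swap_mul haF hm
    -- The word `t` does not move `a`, so the product sends `a` to `q`; fixing `a` forces `q = a`.
    have ha := hC a (Finset.mem_insert_self a C)
    rw [map_mul, mul_apply, map_apply_of_notMem hs ht haF, hs] at ha
    have : q = a := by
      rw [← ha]
      exact (Equiv.swap_apply_left a q).symm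
    rwa [this, h.s_self, one_mul]

/-- Lets a replacement pass a permutation word at the cost of renaming its indices. -/
theorem repl_mul_of_mem {F : Set α} {m : N}
    (hm : m ∈ swapMonoid s F) (i j : α) :
    r (φ m i) (φ m j) * m = m * r i j := by
  induction hm using Submonoid.closure_induction_left with
  | one => rw [map_one, one_apply, one_apply, one_mul, mul_one]
  | mul_left g hg m hm ih =>
    obtain ⟨k, hk, l, hl, rfl⟩ := hg
    rw [map_mul, mul_apply, mul_apply, hs, mul_assoc, ← ih, ← mul_assoc, ← mul_assoc,
      h.swap_mul_repl]
    rfl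

end Relations
end SubstRel

namespace SubstRel

/-! ### Idempotents and the normal form -/

/-- The submonoid generated by the `r x (ε x)`. -/
abbrev replMonoid {α N : Type*} [Monoid N] (r : α → α → N) (ε : α → α) : Submonoid N :=
  Submonoid.closure {m | ∃ x, m = r x (ε x)}

/-- `e` is the least element of the semilattice of idempotents generated by the `r x (ε x)`,
where `ε` is the map that belongs to `e`, and `ε` maps every point to the least point with
the same value. -/
structure IsRetraction {α N : Type*} [Monoid N] [LE α] (r : α → α → N) (φ : N →* Function.End α)
    (e : N) : Prop where
  mem : e ∈ replMonoid r (φ e)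
  repl_mul : ∀ x, r x (φ e x) * e = e
  apply_le : ∀ x, φ e x ≤ x

section NormalForm

variable {α N : Type*} [LinearOrder α] [Monoid N] {s r : α → α → N} {φ : N →* Function.End α}

omit [LinearOrder α] in
theorem map_mul_apply (m m' : N) (x : α) : φ (m * m') x = φ m (φ m' x) := by
  rw [map_mul, mul_apply]

theorem IsRetraction.apply_apply {e : N} (he : IsRetraction r φ e)
    (hr : ∀ i j, φ (r i j) = replEnd i j) (x : α) : φ e (φ e x) = φ e x := by
  have := congrFun (congrArg φ (he.repl_mul (φ e x))) x
  rwa [map_mul, mul_apply, hr, replEnd_apply, if_pos rfl] at this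

theorem IsRetraction.mul_of_mem {e m : N} (he : IsRetraction r φ e)
    (hm : m ∈ replMonoid r (φ e)) : m * e = e := by
  induction hm using Submonoid.closure_induction_left with
  | one => exact one_mul e
  | mul_left g hg m hm ih =>
    obtain ⟨x, rfl⟩ := hg
    rw [mul_assoc, ih, he.repl_mul]

variable (h : SubstRel s r)
include h

/-- If the source of one factor is the target of another, it is a fixed point of the idempotent `ε`,
so its own factor is `1`; all other pairs commute by `repl_comm`. -/
theorem replMonoid_comm {ε : α → α} (hε : ∀ x, ε (ε x) = ε x) {m m' : N}
    (hm : m ∈ replMonoid r ε) (hm' : m' ∈ replMonoid r ε) : m * m' = m' * m := by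
  have key : ∀ x y, r x (ε x) * r y (ε y) = r y (ε y) * r x (ε x) := by
    intro x y
    by_cases hxy : x = y
    · rw [hxy]
    by_cases h1 : x = ε y
    · rw [h1, hε, h.r_self, one_mul, mul_one]
    by_cases h2 : y = ε x
    · rw [h2, hε, h.r_self, one_mul, mul_one]
    exact h.repl_comm hxy h1 h2
  induction hm, hm' using Submonoid.closure_induction₂ with
  | mem x y hx hy =>
    obtain ⟨x, rfl⟩ := hx
    obtain ⟨y, rfl⟩ := hy
    exact key x y
  | one_left x hx => rw [one_mul, mul_one]
  | one_right x hx => rw [one_mul, mul_one]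
  | mul_left x y z hx hy hz h1 h2 => rw [mul_assoc, h2, ← mul_assoc, h1, mul_assoc]
  | mul_right x y z hx hy hz h1 h2 => rw [← mul_assoc, h1, mul_assoc, h2, mul_assoc]

variable (hr : ∀ i j, φ (r i j) = replEnd i j)
include hr

/-- A least element of a semilattice is unique: `e` and `e'` absorb each other and commute. -/
theorem IsRetraction.eq {e e' : N} (he : IsRetraction r φ e) (he' : IsRetraction r φ e')
    (hee : φ e = φ e') : e = e' := by
  have h1 : e' * e = e := he.mul_of_mem (hee ▸ he'.mem)
  have h2 : e * e' = e' := he'.mul_of_mem (hee ▸ he.mem)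
  rw [← h1, ← h.replMonoid_comm (he.apply_apply hr) he.mem (hee ▸ he'.mem), h2]

/-- Two retractions whose maps have the same kernel are equal. -/
theorem IsRetraction.eq_of_ker {e e' : N} (he : IsRetraction r φ e) (he' : IsRetraction r φ e')
    (hee : ∀ x y, φ e x = φ e y ↔ φ e' x = φ e' y) : e = e' := by
  refine he.eq h hr he' (funext fun x => le_antisymm ?_ ?_)
  · rw [← (hee _ _).2 (he'.apply_apply hr x)]
    exact he.apply_le _
  · rw [← (hee _ _).1 (he.apply_apply hr x)]
    exact he'.apply_le _

omit hr in
theorem isRetraction_one : IsRetraction r φ 1 where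
  mem := one_mem _
  repl_mul x := by rw [map_one, one_apply, h.r_self, one_mul]
  apply_le x := by rw [map_one, one_apply]

/-- Merging the classes of two fixed points of a retraction. -/
theorem IsRetraction.repl_mul_isRetraction {e : N} (he : IsRetraction r φ e) {i j : α}
    (hi : φ e i = i) (hj : φ e j = j) (hji : j < i) : IsRetraction r φ (r i j * e) := by
  have hval : ∀ x, φ (r i j * e) x = if φ e x = i then j else φ e x := fun x => by
    rw [map_mul, mul_apply, hr, replEnd_apply]
  have hne : ∀ x, φ e x ≠ i → r i j * r x (φ e x) = r x (φ e x) * r i j := by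
    intro x hx
    by_cases hxj : x = j
    · rw [hxj, hj, h.r_self, one_mul, mul_one]
    · exact h.repl_comm (fun e => hx (e ▸ hi)) (Ne.symm hx) hxj
  have hcomm : ∀ x, x ≠ i → r i j * r x j = r x j * r i j := by
    intro x hx
    by_cases hxj : x = j
    · rw [hxj, h.r_self, one_mul, mul_one]
    · exact h.repl_comm hx.symm hji.ne' hxj
  have heq : ∀ x, x ≠ i → r i j * r x i = r x j * r i j := by
    intro x hx
    by_cases hxj : x = j
    · subst hxj
      rw [h.r_self, one_mul, h.r_back x i hji.ne]
    · rw [← hcomm x hx, ← h.r_chain j i x hji.ne (Ne.symm hxj) hx.symm]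
  refine ⟨?_, fun x => ?_, fun x => ?_⟩
  -- Move `r i j` from the left end to the right end. Passing a factor with target `i` redirects it
  -- to `j`; other factors commute with `r i j`, and a factor with source `i` is `1`.
  · have key : ∀ m ∈ replMonoid r (φ e), ∃ m' ∈ replMonoid r (φ (r i j * e)),
        r i j * m = m' * r i j := by
      intro m hm
      induction hm using Submonoid.closure_induction_left with
      | one => exact ⟨1, one_mem _, by rw [one_mul, mul_one]⟩
      | mul_left g hg m hm ih =>
        obtain ⟨x, rfl⟩ := hg
        obtain ⟨m', hm', ih⟩ := ih
        have hx : r x (φ (r i j * e) x) ∈ replMonoid r (φ (r i j * e)) :=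
          Submonoid.subset_closure ⟨x, rfl⟩
        by_cases hxi : x = i
        · refine ⟨m', hm', ?_⟩
          rw [hxi, hi, h.r_self, one_mul, ih]
        refine ⟨r x (φ (r i j * e) x) * m', mul_mem hx hm', ?_⟩
        rw [mul_assoc, ← ih, ← mul_assoc, ← mul_assoc, hval]
        split_ifs with hx'
        · rw [hx', heq x hxi]
        · rw [hne x hx']
    obtain ⟨m', hm', h1⟩ := key e he.mem
    rw [h1]
    rw [h1] at hm'
    refine mul_mem hm' (Submonoid.subset_closure ⟨i, ?_⟩)
    rw [← h1, hval, if_pos hi]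
  · rw [hval, ← mul_assoc]
    split_ifs with hx
    · by_cases hxi : x = i
      · rw [hxi, h.r_idem j i hji.ne]
      · rw [← heq x hxi, mul_assoc, ← hx, he.repl_mul]
    · rw [← hne x hx, mul_assoc, he.repl_mul]
  · rw [hval]
    split_ifs with hx
    · exact hji.le.trans (hx ▸ he.apply_le x)
    · exact he.apply_le x

variable (hs : ∀ i j, φ (s i j) = swapEnd i j)
include hs

-- Left multiplication by a replacement preserves the normal form. A new retraction arises only when
-- `i` and `j` are both fixed points, so that two classes merge; for `i < j` a transposition first
-- makes the smaller point the representative.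
omit hs in
theorem exists_repl_mul {e : N} (he : IsRetraction r φ e) (i j : α) :
    ∃ p ∈ swapMonoid s Set.univ, ∃ e', IsRetraction r φ e' ∧ r i j * e = p * e' := by
  have hmem : s i j ∈ swapMonoid s Set.univ :=
    Submonoid.subset_closure ⟨i, trivial, j, trivial, rfl⟩
  by_cases hij : i = j
  · exact ⟨1, one_mem _, e, he, by rw [hij, h.r_self]⟩
  by_cases hi : φ e i = i
  · by_cases hj : φ e j = j
    · rcases lt_or_gt_of_ne hij with hlt | hlt
      · refine ⟨s i j, hmem, r j i * e, he.repl_mul_isRetraction h hr hj hi hlt, ?_⟩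
        rw [h.repl_eq_swap_mul hij, mul_assoc]
      · exact ⟨1, one_mem _, r i j * e, he.repl_mul_isRetraction h hr hi hj hlt,
          (one_mul _).symm⟩
    -- Here `j` is outside the range of `φ e`, so replacing `i` by `j` after `e` acts like the
    -- transposition.
    · refine ⟨s i j, hmem, e, he, ?_⟩
      by_cases ha : φ e j = i
      · have := he.repl_mul j
        rw [ha] at this
        rw [h.repl_eq_swap_mul hij, mul_assoc, this]
      · have h1 := h.r_shift j i (φ e j) (Ne.symm hij) (Ne.symm hj) (Ne.symm ha)
        have h2 := h.swap_mul_repl i j j (φ e j)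
        rw [Equiv.swap_apply_right, Equiv.swap_apply_of_ne_of_ne ha hj, h.symm i j] at h2
        have h3 := he.repl_mul j
        rw [← h3, ← mul_assoc, h1, ← h2, mul_assoc, h3, h.symm]
  -- Here `i` is outside the range of `φ e`, so the replacement has no effect.
  · refine ⟨1, one_mem _, e, he, ?_⟩
    rw [← he.repl_mul i, ← mul_assoc, h.repl_mul_repl hij (Ne.symm hi), one_mul]

/-- Every product of generators is a product of transpositions times a retraction. -/
theorem exists_normalForm {m : N}
    (hm : m ∈ Submonoid.closure {m | ∃ i j, m = s i j ∨ m = r i j}) :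
    ∃ p ∈ swapMonoid s Set.univ, ∃ e, IsRetraction r φ e ∧ m = p * e := by
  induction hm using Submonoid.closure_induction_left with
  | one => exact ⟨1, one_mem _, 1, h.isRetraction_one, (one_mul 1).symm⟩
  | mul_left g hg m hm ih =>
    obtain ⟨p, hp, e, he, rfl⟩ := ih
    obtain ⟨i, j, rfl | rfl⟩ := hg
    · exact ⟨s i j * p, mul_mem (Submonoid.subset_closure ⟨i, trivial, j, trivial, rfl⟩) hp, e, he,
        (mul_assoc _ _ _).symm⟩
    · obtain ⟨p', hp', h1, h2⟩ := h.exists_inverse hp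
      have hpp : ∀ x, φ p (φ p' x) = x := fun x => by
        rw [← map_mul_apply, h1, map_one, one_apply]
      obtain ⟨q, hq, e', he', h3⟩ := h.exists_repl_mul hr he (φ p' i) (φ p' j)
      refine ⟨p * q, mul_mem hp hq, e', he', ?_⟩
      have h4 := h.repl_mul_of_mem hs hp (φ p' i) (φ p' j)
      rw [hpp, hpp] at h4
      rw [← mul_assoc, h4, mul_assoc, h3, mul_assoc]

/-- The range of `φ e` is its set of fixed points, so `m` can be rewritten using only transpositions
of non-fixed points. Each of these disappears against two replacement factors that `e` absorbs. -/
theorem mul_eq_of_fixes [Fintype α] {e m : N} (he : IsRetraction r φ e)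
    (hm : m ∈ swapMonoid s Set.univ) (hfix : ∀ x, φ m (φ e x) = φ e x) : m * e = e := by
  classical
  have hm' : m ∈ swapMonoid s {x | φ e x ≠ x} := by
    refine h.mem_closure_of_fixes hs (Finset.univ.filter fun x => φ e x = x) ?_ ?_
    · convert hm using 2
      ext x
      simpa using (em (φ e x = x)).symm
    · intro x hx
      rw [Finset.mem_filter] at hx
      rw [← hx.2]
      exact hfix x
  clear hm hfix
  induction hm' using Submonoid.closure_induction_left with
  | one => exact one_mul e
  | mul_left g hg m hm ih =>
    obtain ⟨k, hk, l, hl, rfl⟩ := hg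
    rw [mul_assoc, ih]
    by_cases hkl : k = l
    · rw [hkl, h.s_self, one_mul]
    have hid := he.apply_apply hr
    have hkb : k ≠ φ e l := fun e' => hk (by rw [e', hid])
    have hla : l ≠ φ e k := fun e' => hl (by rw [e', hid])
    have := h.swap_mul_repl_mul_repl hkl (Ne.symm hk) hkb hla (Ne.symm hl)
    have h1 : r k (φ e k) * r l (φ e l) * e = e := by rw [mul_assoc, he.repl_mul, he.repl_mul]
    rw [← h1, ← mul_assoc, this]

/-- The relations present the monoid of self-maps: a product of generators is determined by the
map that belongs to it. -/
theorem injOn_closure [Fintype α] :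
    Set.InjOn φ (Submonoid.closure {m | ∃ i j, m = s i j ∨ m = r i j} : Submonoid N) := by
  intro m hm m' hm' hφ
  obtain ⟨p, hp, e, he, rfl⟩ := h.exists_normalForm hr hs hm
  obtain ⟨p', hp', e', he', rfl⟩ := h.exists_normalForm hr hs hm'
  obtain ⟨t, ht, hpt, htp⟩ := h.exists_inverse hp
  obtain ⟨t', ht', hpt', htp'⟩ := h.exists_inverse hp'
  have hinj : ∀ {p t : N}, t * p = 1 → Function.Injective (φ p) := fun {p t} htp =>
    Function.LeftInverse.injective (g := φ t) fun x => by
      rw [← map_mul_apply, htp, map_one, one_apply]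
  have hφ' : ∀ x, φ p (φ e x) = φ p' (φ e' x) := fun x => by
    rw [← map_mul_apply, ← map_mul_apply, hφ]
  -- The permutation parts are injective, so both retractions have the kernel of the common map.
  have hee : e = e' := he.eq_of_ker h hr he' fun x y => by
    rw [← (hinj htp).eq_iff, hφ', hφ', (hinj htp').eq_iff]
  subst hee
  -- The two permutation parts agree on the range of `φ e`, so `t' * p` fixes it pointwise.
  have h1 : t' * p * e = e := h.mul_eq_of_fixes hr hs he (mul_mem ht' hp) fun x => by
    rw [map_mul, mul_apply, hφ', ← map_mul_apply, htp', map_one, one_apply]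
  calc p * e = p' * t' * (p * e) := by rw [hpt', one_mul]
    _ = p' * (t' * p * e) := by simp only [mul_assoc]
    _ = p' * e := by rw [h1]

end NormalForm
end SubstRel

/-! ### Semantics of the sentences -/

section Semantics

variable (n : ℕ) {M : Type u} [(lang n).Structure M]

/-- The meet operation of an algebra. -/
def meetOp (a b : M) : M := Structure.funMap (L := lang n) Op.meet ![a, b]

/-- The complement operation of an algebra. -/
def complOp (a : M) : M := Structure.funMap (L := lang n) Op.compl ![a]

/-- The join operation of an algebra. -/
def joinOp (a b : M) : M := complOp n (meetOp n (complOp n a) (complOp n b))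

variable {n}

/-- The transposition operation `s_{ij}` of an algebra. -/
def swapOp (M : Type u) [(lang n).Structure M] (i j : Fin n) (h : i ≠ j) (a : M) : M :=
  Structure.funMap (L := lang n) (Op.swap i j h) ![a]

section Terms

variable {α : Type} (v : α → M)

theorem realize_tMeet (t u : (lang n).Term α) :
    (tMeet t u).realize v = meetOp n (t.realize v) (u.realize v) :=
  Term.realize_functions_apply₂

theorem realize_tCompl (t : (lang n).Term α) :
    (tCompl t).realize v = complOp n (t.realize v) :=
  Term.realize_functions_apply₁

theorem realize_tJoin (t u : (lang n).Term α) :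
    (tJoin t u).realize v = joinOp n (t.realize v) (u.realize v) := by
  simp only [tJoin, joinOp, realize_tMeet, realize_tCompl]

theorem realize_tRepl (i j : Fin n) (h : i ≠ j) (t : (lang n).Term α) :
    (tRepl i j h t).realize v = replOp M i j h (t.realize v) :=
  Term.realize_functions_apply₁

theorem realize_tSwap (i j : Fin n) (h : i ≠ j) (t : (lang n).Term α) :
    (tSwap i j h t).realize v = swapOp M i j h (t.realize v) :=
  Term.realize_functions_apply₁

end Terms

theorem realize_var {k : ℕ} (v : Empty → M) (w : Fin k → M) (i : Fin k) :
    (var i : (lang n).Term (Empty ⊕ Fin k)).realize (Sum.elim v w) = w i := rfl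

theorem realize_x (v : Empty → M) (a b c : M) :
    (x : (lang n).Term (Empty ⊕ Fin 3)).realize (Sum.elim v ![a, b, c]) = a := rfl

theorem realize_y (v : Empty → M) (a b c : M) :
    (y : (lang n).Term (Empty ⊕ Fin 3)).realize (Sum.elim v ![a, b, c]) = b := rfl

theorem realize_z (v : Empty → M) (a b c : M) :
    (z : (lang n).Term (Empty ⊕ Fin 3)).realize (Sum.elim v ![a, b, c]) = c := rfl

theorem realize_eqn (t u : (lang n).Term (Empty ⊕ Fin 3)) :
    Sentence.Realize M (eqn t u) ↔
      ∀ a b c : M, t.realize (Sum.elim (default : Empty → M) ![a, b, c]) =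
        u.realize (Sum.elim (default : Empty → M) ![a, b, c]) := by
  rw [Sentence.Realize, eqn, BoundedFormula.realize_alls]
  simp only [BoundedFormula.realize_bdEqual]
  refine ⟨fun h a b c => h ![a, b, c], fun h w => ?_⟩
  have := h (w 0) (w 1) (w 2)
  rwa [show ![w 0, w 1, w 2] = w from by ext i; fin_cases i <;> rfl] at this

theorem realize_atF (v : Empty → M) (w : Fin 2 → M) :
    (atF : (lang n).BoundedFormula Empty 2).Realize v w ↔
      w 1 ≠ meetOp n (w 1) (complOp n (w 1)) ∧
        ∀ b, meetOp n b (w 1) = b → b = meetOp n b (complOp n b) ∨ b = w 1 := by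
  simp only [atF, isZero, le, BoundedFormula.realize_inf, BoundedFormula.realize_not,
    BoundedFormula.realize_all, BoundedFormula.realize_imp, BoundedFormula.realize_sup,
    BoundedFormula.realize_bdEqual, realize_tMeet, realize_tCompl, realize_var]
  rfl

theorem realize_atomicity :
    Sentence.Realize M (atomicity (n := n)) ↔
      ∀ y : M, y ≠ meetOp n y (complOp n y) → ∃ a : M, (a ≠ meetOp n a (complOp n a) ∧
        ∀ b, meetOp n b a = b → b = meetOp n b (complOp n b) ∨ b = a) ∧ meetOp n a y = a := by
  simp only [Sentence.Realize, Formula.Realize, atomicity, isZero, le,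
    BoundedFormula.realize_inf, BoundedFormula.realize_not, BoundedFormula.realize_ex,
    BoundedFormula.realize_all, BoundedFormula.realize_imp, realize_atF,
    BoundedFormula.realize_bdEqual, realize_tMeet, realize_tCompl, realize_var]
  rfl

theorem realize_psi (i j : Fin n) (h : i ≠ j) :
    Sentence.Realize M (psi i j h) ↔
      ∀ y : M, y ≠ meetOp n y (complOp n y) → ∃ a : M, (a ≠ meetOp n a (complOp n a) ∧
        ∀ b, meetOp n b a = b → b = meetOp n b (complOp n b) ∨ b = a) ∧
        meetOp n (replOp M i j h a) y ≠
          meetOp n (meetOp n (replOp M i j h a) y) (complOp n (meetOp n (replOp M i j h a) y)) := by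
  simp only [Sentence.Realize, Formula.Realize, psi, isZero,
    BoundedFormula.realize_inf, BoundedFormula.realize_not, BoundedFormula.realize_ex,
    BoundedFormula.realize_all, BoundedFormula.realize_imp, realize_atF,
    BoundedFormula.realize_bdEqual, realize_tMeet, realize_tCompl, realize_tRepl, realize_var]
  rfl

end Semantics

/-! ### Models of `Σ_n`: Boolean structure and the monoid relations. -/

section Models

variable {n : ℕ} {M : Type u} [(lang n).Structure M]

theorem realize_of_saEq (hM : M ⊨ saTheory n) {t u : (lang n).Term (Empty ⊕ Fin 3)}
    (h : SAEq n (eqn t u)) (a b c : M) :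
    t.realize (Sum.elim (default : Empty → M) ![a, b, c]) =
      u.realize (Sum.elim (default : Empty → M) ![a, b, c]) :=
  (realize_eqn t u).1 (hM.realize_of_mem _ h) a b c

section Boolean

variable (hM : M ⊨ saTheory n) (a b c : M)
include hM

theorem meetOp_comm : meetOp n a b = meetOp n b a := by
  simpa only [realize_tMeet, realize_x, realize_y] using realize_of_saEq hM .meet_comm a b a

theorem meetOp_assoc : meetOp n (meetOp n a b) c = meetOp n a (meetOp n b c) := by
  simpa only [realize_tMeet, realize_x, realize_y, realize_z] using
    realize_of_saEq hM .meet_assoc a b c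

theorem joinOp_comm : joinOp n a b = joinOp n b a := by
  simpa only [realize_tJoin, realize_x, realize_y] using realize_of_saEq hM .join_comm a b a

theorem joinOp_assoc : joinOp n (joinOp n a b) c = joinOp n a (joinOp n b c) := by
  simpa only [realize_tJoin, realize_x, realize_y, realize_z] using
    realize_of_saEq hM .join_assoc a b c

theorem meetOp_joinOp_self : meetOp n a (joinOp n a b) = a := by
  simpa only [realize_tJoin, realize_tMeet, realize_x, realize_y] using
    realize_of_saEq hM .absorb_meet a b a

theorem joinOp_meetOp_self : joinOp n a (meetOp n a b) = a := by
  simpa only [realize_tJoin, realize_tMeet, realize_x, realize_y] using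
    realize_of_saEq hM .absorb_join a b a

theorem meetOp_joinOp_distrib :
    meetOp n a (joinOp n b c) = joinOp n (meetOp n a b) (meetOp n a c) := by
  simpa only [realize_tJoin, realize_tMeet, realize_x, realize_y, realize_z] using
    realize_of_saEq hM .distrib a b c

theorem meetOp_complOp_meetOp :
    meetOp n (meetOp n a (complOp n a)) b = meetOp n a (complOp n a) := by
  simpa only [realize_tCompl, realize_tMeet, realize_x, realize_y] using
    realize_of_saEq hM .zero_le a b a

theorem joinOp_complOp_meetOp : meetOp n (joinOp n a (complOp n a)) b = b := by
  simpa only [realize_tCompl, realize_tJoin, realize_tMeet, realize_x, realize_y] using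
    realize_of_saEq hM .le_one a b a

theorem replOp_meetOp (i j : Fin n) (h : i ≠ j) :
    replOp M i j h (meetOp n a b) = meetOp n (replOp M i j h a) (replOp M i j h b) := by
  simpa only [realize_tRepl, realize_tMeet, realize_x, realize_y] using
    realize_of_saEq hM (.repl_meet i j h) a b a

theorem replOp_complOp (i j : Fin n) (h : i ≠ j) :
    replOp M i j h (complOp n a) = complOp n (replOp M i j h a) := by
  simpa only [realize_tRepl, realize_tCompl, realize_x] using
    realize_of_saEq hM (.repl_compl i j h) a a a

theorem swapOp_meetOp (i j : Fin n) (h : i ≠ j) :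
    swapOp M i j h (meetOp n a b) = meetOp n (swapOp M i j h a) (swapOp M i j h b) := by
  simpa only [realize_tSwap, realize_tMeet, realize_x, realize_y] using
    realize_of_saEq hM (.swap_meet i j h) a b a

theorem swapOp_complOp (i j : Fin n) (h : i ≠ j) :
    swapOp M i j h (complOp n a) = complOp n (swapOp M i j h a) := by
  simpa only [realize_tSwap, realize_tCompl, realize_x] using
    realize_of_saEq hM (.swap_compl i j h) a a a

theorem swapOp_swapOp (i j : Fin n) (h : i ≠ j) : swapOp M i j h (swapOp M i j h a) = a := by
  simpa only [realize_tSwap, realize_x] using realize_of_saEq hM (.swap_invol i j h) a a a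

end Boolean

/-- The Boolean algebra underlying a model of the equations. -/
@[reducible]
noncomputable def boolAlg [Nonempty M] (hM : M ⊨ saTheory n) : BooleanAlgebra M :=
  letI : Max M := ⟨joinOp n⟩
  letI : Min M := ⟨meetOp n⟩
  letI : Lattice M := Lattice.mk' (joinOp_comm hM) (joinOp_assoc hM) (meetOp_comm hM)
    (meetOp_assoc hM) (joinOp_meetOp_self hM) (meetOp_joinOp_self hM)
  letI : DistribLattice M := DistribLattice.ofInfSupLe
    (fun a b c => le_of_eq (meetOp_joinOp_distrib hM a b c))
  -- Zero and one are not basic operations: `a · -a` is least and `a + -a` greatest for every `a`,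
  -- so any element can be used to define them.
  have hbot (a b : M) : a ⊓ complOp n a ≤ b := inf_eq_left.1 (meetOp_complOp_meetOp hM a b)
  have htop (a b : M) : b ≤ a ⊔ complOp n a := inf_eq_right.1 (joinOp_complOp_meetOp hM a b)
  { (inferInstance : DistribLattice M) with
    compl := complOp n
    top := Classical.arbitrary M ⊔ complOp n (Classical.arbitrary M)
    bot := Classical.arbitrary M ⊓ complOp n (Classical.arbitrary M)
    le_top := fun b => htop _ b
    bot_le := fun b => hbot _ b
    inf_compl_le_bot := fun a => hbot a _
    top_le_sup_compl := fun a => htop a _ }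

/-- The transposition operations, with the identity for equal indices. -/
def swapHom (M : Type u) [(lang n).Structure M] (i j : Fin n) : Function.End M :=
  if h : i ≠ j then swapOp M i j h else 1

/-- The replacement operations, with the identity for equal indices. -/
def replHom (M : Type u) [(lang n).Structure M] (i j : Fin n) : Function.End M :=
  if h : i ≠ j then replOp M i j h else 1

theorem swapHom_of_ne {i j : Fin n} (h : i ≠ j) : swapHom M i j = swapOp M i j h := dif_pos h

theorem replHom_of_ne {i j : Fin n} (h : i ≠ j) : replHom M i j = replOp M i j h := dif_pos h

theorem substRel (hM : M ⊨ saTheory n) :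
    SubstRel (swapHom M : Fin n → Fin n → _) (replHom M) where
  s_self i := dif_neg (not_not.2 rfl)
  r_self i := dif_neg (not_not.2 rfl)
  s_symm i j hij := funext fun a => by
    rw [swapHom_of_ne hij, swapHom_of_ne hij.symm]
    have e := realize_of_saEq hM (.swap_symm i j hij) a a a
    simp only [realize_tSwap, realize_x] at e
    exact e
  s_invol i j hij := funext fun a => by
    rw [swapHom_of_ne hij]
    have e := realize_of_saEq hM (.swap_invol i j hij) a a a
    simp only [realize_tSwap, realize_x] at e
    exact e
  s_conj i j k hij hik hjk := funext fun a => by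
    rw [swapHom_of_ne hij, swapHom_of_ne hik, swapHom_of_ne hjk]
    have e := realize_of_saEq hM (.swap_conj i j k hij hik hjk) a a a
    simp only [realize_tSwap, realize_x] at e
    exact e
  s_comm i j k l hij hik hil hjk hjl hkl := funext fun a => by
    rw [swapHom_of_ne hij, swapHom_of_ne hkl]
    have e := realize_of_saEq hM (.swap_swap i j k l hij hik hil hjk hjl hkl) a a a
    simp only [realize_tSwap, realize_x] at e
    exact e
  conj_disjoint i j k l hij hik hil hjk hjl hkl := funext fun a => by
    rw [swapHom_of_ne hkl, replHom_of_ne hij.symm]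
    have e := realize_of_saEq hM (.conj_disjoint i j k l hij hik hil hjk hjl hkl) a a a
    simp only [realize_tSwap, realize_tRepl, realize_x] at e
    exact e
  conj_source i j k hij hik hjk := funext fun a => by
    rw [swapHom_of_ne hjk, replHom_of_ne hij.symm, replHom_of_ne hik.symm]
    have e := realize_of_saEq hM (.conj_source i j k hij hik hjk) a a a
    simp only [realize_tSwap, realize_tRepl, realize_x] at e
    exact e
  conj_target i j k hij hik hjk := funext fun a => by
    rw [swapHom_of_ne hik.symm, replHom_of_ne hij.symm, replHom_of_ne hjk]
    have e := realize_of_saEq hM (.conj_target i j k hij hik hjk) a a a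
    simp only [realize_tSwap, realize_tRepl, realize_x] at e
    exact e
  conj_self i j hij := funext fun a => by
    rw [swapHom_of_ne hij, replHom_of_ne hij.symm, replHom_of_ne hij]
    have e := realize_of_saEq hM (.conj_self i j hij) a a a
    simp only [realize_tSwap, realize_tRepl, realize_x] at e
    exact e
  r_disjoint i j k l hij hik hil hjk hjl hkl := funext fun a => by
    rw [replHom_of_ne hij.symm, replHom_of_ne hkl]
    have e := realize_of_saEq hM (.repl_disjoint i j k l hij hik hil hjk hjl hkl) a a a
    simp only [realize_tRepl, realize_x] at e
    exact e
  r_same_target i j k hij hik hjk := funext fun a => by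
    rw [replHom_of_ne hij.symm, replHom_of_ne hik.symm]
    have e := realize_of_saEq hM (.repl_same_target i j k hij hik hjk) a a a
    simp only [realize_tRepl, realize_x] at e
    exact e
  r_chain i j k hij hik hjk := funext fun a => by
    rw [replHom_of_ne hij.symm, replHom_of_ne hik.symm, replHom_of_ne hjk.symm]
    have e := realize_of_saEq hM (.repl_chain i j k hij hik hjk) a a a
    simp only [realize_tRepl, realize_x] at e
    exact e
  r_shift i j k hij hik hjk := funext fun a => by
    rw [replHom_of_ne hij.symm, replHom_of_ne hik, replHom_of_ne hjk, swapHom_of_ne hij]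
    have e := realize_of_saEq hM (.repl_shift i j k hij hik hjk) a a a
    simp only [realize_tSwap, realize_tRepl, realize_x] at e
    exact e
  r_same_source i j k hij hik hjk := funext fun a => by
    rw [replHom_of_ne hij.symm, replHom_of_ne hjk]
    have e := realize_of_saEq hM (.repl_same_source i j k hij hik hjk) a a a
    simp only [realize_tRepl, realize_x] at e
    exact e
  r_idem i j hij := funext fun a => by
    rw [replHom_of_ne hij.symm]
    have e := realize_of_saEq hM (.repl_idem i j hij) a a a
    simp only [realize_tRepl, realize_x] at e
    exact e
  r_back i j hij := funext fun a => by
    rw [replHom_of_ne hij.symm, replHom_of_ne hij]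
    have e := realize_of_saEq hM (.repl_back i j hij) a a a
    simp only [realize_tRepl, realize_x] at e
    exact e
  r_swap i j hij := funext fun a => by
    rw [replHom_of_ne hij.symm, swapHom_of_ne hij]
    have e := realize_of_saEq hM (.repl_swap i j hij) a a a
    simp only [realize_tSwap, realize_tRepl, realize_x] at e
    exact e

end Models

/-! ### Complete Boolean endomorphisms -/

section CompleteHom

variable {B : Type*} [BooleanAlgebra B]

/-- `f` preserves meets and complements. -/
structure IsBoolHom (f : B → B) : Prop where
  map_inf : ∀ a b, f (a ⊓ b) = f a ⊓ f b
  map_compl : ∀ a, f aᶜ = (f a)ᶜ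

theorem IsBoolHom.mono {f : B → B} (hf : IsBoolHom f) : Monotone f := fun a b hab => by
  rw [← inf_eq_left] at hab ⊢
  rw [← hf.map_inf, hab]

theorem IsBoolHom.map_bot {f : B → B} (hf : IsBoolHom f) : f ⊥ = ⊥ := by
  have := hf.map_inf ⊥ ⊥ᶜ
  rwa [hf.map_compl, inf_compl_self, inf_compl_self] at this

theorem IsBoolHom.map_top {f : B → B} (hf : IsBoolHom f) : f ⊤ = ⊤ := by
  rw [← compl_bot, hf.map_compl, hf.map_bot]

/-- If the images of the atoms are dense then all joins are preserved. -/
theorem IsBoolHom.isLUB_image {f : B → B} (hf : IsBoolHom f)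
    (hat : ∀ y : B, y ≠ ⊥ → ∃ a, IsAtom a ∧ f a ⊓ y ≠ ⊥) {X : Set B} {m : B} (hm : IsLUB X m) :
    IsLUB (f '' X) (f m) := by
  refine ⟨hf.mono.mem_upperBounds_image hm.1, fun z hz => ?_⟩
  by_contra hle
  obtain ⟨a, ha, hay⟩ := hat (f m ⊓ zᶜ) fun h => hle (disjoint_compl_right_iff.1 (disjoint_iff.2 h))
  -- The element `f a` meets `f m`, so the atom `a` cannot be disjoint from `m`.
  have ham : a ≤ m := by
    by_contra h
    have h0 : a ⊓ m = ⊥ := disjoint_iff.1 (ha.not_le_iff_disjoint.1 h)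
    exact hay (by rw [← inf_assoc, ← hf.map_inf, h0, hf.map_bot, bot_inf_eq])
  -- Otherwise `aᶜ` bounds `X`, and then `a ≤ m ≤ aᶜ`.
  obtain ⟨x, hx, hax⟩ : ∃ x ∈ X, a ≤ x := by
    by_contra! h
    have : m ≤ aᶜ := hm.2 fun x hx =>
      (ha.not_le_iff_disjoint.1 (h x hx)).symm.le_compl_right
    exact ha.1 (le_bot_iff.1 (inf_compl_self a ▸ le_inf le_rfl (ham.trans this)))
  have hfz : f a ≤ z := (hf.mono hax).trans (hz ⟨x, hx, rfl⟩)
  refine hay (le_bot_iff.1 ?_)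
  calc f a ⊓ (f m ⊓ zᶜ) ≤ z ⊓ zᶜ := inf_le_inf hfz inf_le_right
    _ = ⊥ := inf_compl_self z

theorem isLUB_setOf_isAtom (hB : ∀ y : B, y ≠ ⊥ → ∃ a, IsAtom a ∧ a ≤ y) :
    IsLUB {a : B | IsAtom a} ⊤ := by
  refine ⟨fun a _ => le_top, fun z hz => ?_⟩
  by_contra h
  obtain ⟨a, ha, haz⟩ := hB zᶜ fun h0 => h (compl_eq_bot.1 h0).ge
  exact ha.1 (le_bot_iff.1 (inf_compl_self z ▸ le_inf (hz ha) haz))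

/-- In an atomic Boolean algebra, an endomorphism is completely additive if and only if the
images of the atoms are dense. -/
theorem IsBoolHom.dense_iff {f : B → B} (hf : IsBoolHom f)
    (hB : ∀ y : B, y ≠ ⊥ → ∃ a, IsAtom a ∧ a ≤ y) :
    (∀ y : B, y ≠ ⊥ → ∃ a, IsAtom a ∧ f a ⊓ y ≠ ⊥) ↔
      ∀ (X : Set B) (m : B), IsLUB X m → IsLUB (f '' X) (f m) := by
  refine ⟨fun h X m hm => hf.isLUB_image h hm, fun h y hy => ?_⟩
  by_contra! h0
  -- By atomicity `⊤` is the join of the atoms; complete additivity is needed only for this join.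
  have : f ⊤ ≤ yᶜ := (h _ _ (isLUB_setOf_isAtom hB)).2 (by
    rintro _ ⟨a, ha, rfl⟩
    exact (disjoint_iff.2 (h0 a ha)).le_compl_right)
  rw [hf.map_top] at this
  exact hy (compl_eq_top.1 (top_le_iff.1 this))

/-- Boolean endomorphisms preserving all existing meets. -/
structure IsCompleteHom (f : B → B) : Prop extends IsBoolHom f where
  isGLB_image : ∀ (X : Set B) (m : B), IsGLB X m → IsGLB (f '' X) (f m)

theorem isGLB_iff_isLUB_compl {X : Set B} {m : B} : IsGLB X m ↔ IsLUB (compl '' X) mᶜ := by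
  constructor
  · refine fun h => ⟨?_, fun z hz => ?_⟩
    · rintro _ ⟨x, hx, rfl⟩
      exact compl_le_compl (h.1 hx)
    · exact compl_le_of_compl_le (h.2 fun x hx => compl_le_of_compl_le (hz ⟨x, hx, rfl⟩))
  · refine fun h => ⟨fun x hx => compl_le_compl_iff_le.1 (h.1 ⟨x, hx, rfl⟩), fun z hz => ?_⟩
    refine compl_le_compl_iff_le.1 (h.2 ?_)
    rintro _ ⟨x, hx, rfl⟩
    exact compl_le_compl (hz hx)

theorem IsBoolHom.isCompleteHom {f : B → B} (hf : IsBoolHom f)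
    (h : ∀ (X : Set B) (m : B), IsLUB X m → IsLUB (f '' X) (f m)) : IsCompleteHom f where
  toIsBoolHom := hf
  isGLB_image X m hm := by
    rw [isGLB_iff_isLUB_compl] at hm ⊢
    have := h _ _ hm
    rw [hf.map_compl, Set.image_image] at this
    rw [Set.image_image]
    simpa only [hf.map_compl] using this

theorem IsBoolHom.isCompleteHom_of_involutive {f : B → B} (hf : IsBoolHom f)
    (h : Function.Involutive f) : IsCompleteHom f where
  toIsBoolHom := hf
  isGLB_image X m hm := by
    refine ⟨hf.mono.mem_lowerBounds_image hm.1, fun z hz => ?_⟩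
    rw [← h z]
    refine hf.mono (hm.2 fun x hx => ?_)
    rw [← h x]
    exact hf.mono (hz ⟨x, hx, rfl⟩)

theorem isCompleteHom_id : IsCompleteHom (id : B → B) where
  map_inf _ _ := rfl
  map_compl _ := rfl
  isGLB_image X m hm := by rwa [Set.image_id]

theorem IsCompleteHom.comp {f g : B → B} (hf : IsCompleteHom f) (hg : IsCompleteHom g) :
    IsCompleteHom (f ∘ g) where
  map_inf a b := by simp only [Function.comp_apply, hg.map_inf, hf.map_inf]
  map_compl a := by simp only [Function.comp_apply, hg.map_compl, hf.map_compl]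
  isGLB_image X m hm := by
    rw [Set.image_comp]
    exact hf.isGLB_image _ _ (hg.isGLB_image _ _ hm)

theorem atom_le_compl_iff {a b : B} (ha : IsAtom a) : a ≤ bᶜ ↔ ¬ a ≤ b := by
  rw [ha.not_le_iff_disjoint, le_compl_iff_disjoint_right]

end CompleteHom

/-! ### Translation between the first-order sentences and Boolean algebra. -/

section Bridge

variable {n : ℕ} {M : Type u} [(lang n).Structure M] [BooleanAlgebra M]
  (hmeet : ∀ a b : M, meetOp n a b = a ⊓ b) (hcompl : ∀ a : M, complOp n a = aᶜ)
include hmeet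

theorem le_iff (a b : M) : Le n a b ↔ a ≤ b := by
  rw [← inf_eq_left, ← hmeet]
  rfl

theorem isMeet_iff (X : Set M) (m : M) : IsMeet n X m ↔ IsGLB X m := by
  simp only [IsMeet, le_iff hmeet]
  rfl

theorem isJoin_iff (X : Set M) (m : M) : IsJoin n X m ↔ IsLUB X m := by
  simp only [IsJoin, le_iff hmeet]
  rfl

include hcompl

theorem isAtom_iff (a : M) : (a ≠ meetOp n a (complOp n a) ∧
    ∀ b, meetOp n b a = b → b = meetOp n b (complOp n b) ∨ b = a) ↔ IsAtom a := by
  simp only [hmeet, hcompl, inf_compl_self, inf_eq_left]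
  refine and_congr_right fun _ => forall_congr' fun b => ?_
  rw [lt_iff_le_and_ne]
  tauto

theorem realize_atomicity_iff : Sentence.Realize M (atomicity (n := n)) ↔
    ∀ y : M, y ≠ ⊥ → ∃ a, IsAtom a ∧ a ≤ y := by
  rw [realize_atomicity]
  simp only [isAtom_iff hmeet hcompl]
  simp only [hmeet, hcompl, inf_compl_self, inf_eq_left]

theorem realize_psi_iff (i j : Fin n) (h : i ≠ j) : Sentence.Realize M (psi i j h) ↔
    ∀ y : M, y ≠ ⊥ → ∃ a, IsAtom a ∧ replOp M i j h a ⊓ y ≠ ⊥ := by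
  rw [realize_psi]
  simp only [isAtom_iff hmeet hcompl]
  simp only [hmeet, hcompl, inf_compl_self]

theorem isBoolHom_replOp (hM : M ⊨ saTheory n) (i j : Fin n) (h : i ≠ j) :
    IsBoolHom (replOp M i j h) where
  map_inf a b := by simpa only [hmeet] using replOp_meetOp hM a b i j h
  map_compl a := by simpa only [hcompl] using replOp_complOp hM a i j h

theorem isBoolHom_swapOp (hM : M ⊨ saTheory n) (i j : Fin n) (h : i ≠ j) :
    IsBoolHom (swapOp M i j h) where
  map_inf a b := by simpa only [hmeet] using swapOp_meetOp hM a b i j h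
  map_compl a := by simpa only [hcompl] using swapOp_complOp hM a i j h

theorem realize_psi_iff_completelyAdditive (hM : M ⊨ saTheory n)
    (hat : Sentence.Realize M (atomicity (n := n))) (i j : Fin n) (h : i ≠ j) :
    Sentence.Realize M (psi i j h) ↔ CompletelyAdditive n (replOp M i j h) := by
  rw [realize_atomicity_iff hmeet hcompl] at hat
  rw [realize_psi_iff hmeet hcompl, (isBoolHom_replOp hmeet hcompl hM i j h).dense_iff hat]
  simp only [CompletelyAdditive, isJoin_iff hmeet]

/-! ### Completely representable algebras are atomic and satisfy the sentences `ψ` -/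

section Converse

variable {U : Type u} {V : Set (Fin n → U)} (f : M ↪[lang n] Set V)

omit hcompl in
theorem embedding_inf (a b : M) : f (a ⊓ b) = f a ∩ f b := by
  rw [← hmeet]
  exact f.map_fun Op.meet ![a, b]

omit hmeet in
theorem embedding_compl (a : M) : f aᶜ = (f a)ᶜ := by
  rw [← hcompl]
  exact f.map_fun Op.compl ![a]

omit [BooleanAlgebra M] hmeet hcompl in
theorem embedding_replOp (i j : Fin n) (h : i ≠ j) (a : M) :
    f (replOp M i j h a) = setSubst V (replMap i j) (f a) :=
  f.map_fun (Op.repl i j h) ![a]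

theorem embedding_bot : f ⊥ = ∅ := by
  rw [← inf_compl_self (⊥ : M), embedding_inf hmeet, embedding_compl hcompl, Set.inter_compl_self]

/-- In a complete representation every point lies in the image of an atom. -/
theorem exists_isAtom_mem (hf : IsCompleteRep V f) (q : V) : ∃ a : M, IsAtom a ∧ q ∈ f a := by
  -- The algebra need not be complete: that `⊥` is not the meet of this ultrafilter already yields a
  -- nonzero lower bound.
  have hnot : ¬ IsGLB {a : M | q ∈ f a} ⊥ := fun h => by
    have h1 := hf _ _ ((isMeet_iff hmeet _ _).2 h)
    rw [embedding_bot hmeet hcompl] at h1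
    have : q ∈ ⋂ a ∈ {a : M | q ∈ f a}, f a := Set.mem_iInter₂.2 fun a ha => ha
    rw [← h1] at this
    exact this
  obtain ⟨z, hz, hz0⟩ : ∃ z, z ∈ lowerBounds {a : M | q ∈ f a} ∧ z ≠ ⊥ := by
    by_contra! h
    exact hnot ⟨fun a _ => bot_le, fun z hz => (h z hz).le⟩
  have hor : ∀ w, q ∈ f w ∨ q ∈ f wᶜ := fun w => by
    rw [embedding_compl hcompl]
    exact em _
  refine ⟨z, ⟨hz0, fun w hw => ?_⟩, (hor z).resolve_right fun h => hz0 ?_⟩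
  · rcases hor w with h | h
    · exact absurd (hz h) hw.not_ge
    · exact le_bot_iff.1 (inf_compl_self w ▸ le_inf le_rfl (hw.le.trans (hz h)))
  · exact le_bot_iff.1 (inf_compl_self z ▸ le_inf le_rfl (hz h))

omit hcompl in
theorem le_of_isAtom_of_mem {a b : M} (ha : IsAtom a) {q : V} (hqa : q ∈ f a) (hqb : q ∈ f b)
    (hbot : f ⊥ = ∅) : a ≤ b := by
  by_contra h
  have : q ∈ f (a ⊓ b) := by
    rw [embedding_inf hmeet]
    exact ⟨hqa, hqb⟩
  rw [disjoint_iff.1 (ha.not_le_iff_disjoint.1 h), hbot] at this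
  exact this

theorem exists_mem_of_ne_bot {a : M} (ha : a ≠ ⊥) : ∃ q, q ∈ f a := by
  by_contra! h
  refine ha (f.injective ?_)
  rw [embedding_bot hmeet hcompl]
  exact Set.eq_empty_of_forall_notMem h

theorem realize_csaTheory (h : IsCSA n M) : M ⊨ csaTheory n := by
  obtain ⟨hM, U, V, hV, f, hf⟩ := h
  have hbot := embedding_bot hmeet hcompl f
  refine ⟨fun φ hφ => ?_⟩
  rcases hφ with (hφ | rfl) | ⟨i, j, hij, rfl⟩
  · exact hM.realize_of_mem φ hφ
  · rw [realize_atomicity_iff hmeet hcompl]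
    intro y hy
    obtain ⟨q, hq⟩ := exists_mem_of_ne_bot hmeet hcompl f hy
    obtain ⟨a, ha, hqa⟩ := exists_isAtom_mem hmeet hcompl f hf q
    exact ⟨a, ha, le_of_isAtom_of_mem hmeet f ha hqa hq hbot⟩
  · rw [realize_psi_iff hmeet hcompl]
    intro y hy
    obtain ⟨q, hq⟩ := exists_mem_of_ne_bot hmeet hcompl f hy
    -- The atom is chosen at `q ∘ [i|j]`, so that `q` itself lies in the image of `s^i_j a`.
    obtain ⟨a, ha, hqa⟩ := exists_isAtom_mem hmeet hcompl f hf
      ⟨q.1 ∘ replMap i j, (hV i j hij q.1 q.2).1⟩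
    refine ⟨a, ha, fun h0 => ?_⟩
    have : q ∈ f (replOp M i j hij a ⊓ y) := by
      rw [embedding_inf hmeet, embedding_replOp]
      exact ⟨⟨_, hqa, rfl⟩, hq⟩
    rw [h0, hbot] at this
    exact this

end Converse
end Bridge

/-! ### The complete representation -/

section Representation

variable {n : ℕ} (M : Type u) [(lang n).Structure M]

/-- The monoid generated by the pairs of a transposition or replacement and the operation that
belongs to it. -/
def substMonoid : Submonoid (Function.End (Fin n) × Function.End M) :=
  Submonoid.closure {p | ∃ i j : Fin n, p = (SubstRel.swapEnd i j, swapHom M i j) ∨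
    p = (SubstRel.replEnd i j, replHom M i j)}

variable {M}

theorem swap_mem_substMonoid {i j : Fin n} (h : i ≠ j) :
    (SubstRel.swapEnd i j, swapOp M i j h) ∈ substMonoid M :=
  Submonoid.subset_closure ⟨i, j, Or.inl (congrArg _ (swapHom_of_ne h).symm)⟩

theorem repl_mem_substMonoid {i j : Fin n} (h : i ≠ j) :
    (SubstRel.replEnd i j, replOp M i j h) ∈ substMonoid M :=
  Submonoid.subset_closure ⟨i, j, Or.inr (congrArg _ (replHom_of_ne h).symm)⟩

/-- This makes the operation belonging to a self-map well defined. -/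
theorem substMonoid_injOn_fst (hM : M ⊨ saTheory n) {p q : Function.End (Fin n) × Function.End M}
    (hp : p ∈ substMonoid M) (hq : q ∈ substMonoid M) (h : p.1 = q.1) : p = q :=
  ((SubstRel.selfMaps (Fin n)).prod (substRel hM)).injOn_closure
    (φ := MonoidHom.fst (Function.End (Fin n)) (Function.End M))
    (fun _ _ => rfl) (fun _ _ => rfl) hp hq h

/-- The sequence with values in the copy of `Fin n` indexed by `a` given by the map `τ`. -/
def point (a : M) (τ : Function.End (Fin n)) : Fin n → M × Fin n := fun k => (a, τ k)

variable [BooleanAlgebra M]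

variable (M n) in
/-- The unit of the representation: one copy of the generated maps for each atom. -/
def unit : Set (Fin n → M × Fin n) :=
  {q | ∃ a : M, IsAtom a ∧ ∃ p ∈ substMonoid M, q = point a p.1}

/-- The set represented by `y`. -/
def rep (y : M) : Set (unit n M) :=
  {q | ∃ a : M, IsAtom a ∧ ∃ p ∈ substMonoid M, q.1 = point a p.1 ∧ a ≤ p.2 y}

theorem locallySquare_unit : LocallySquare (unit n M) := by
  rintro i j hij _ ⟨a, ha, p, hp, rfl⟩
  exact ⟨⟨a, ha, _, mul_mem hp (repl_mem_substMonoid hij), rfl⟩,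
    ⟨a, ha, _, mul_mem hp (swap_mem_substMonoid hij), rfl⟩⟩

/-- Membership may be tested on any description of the point: the point determines the atom and the
map, and the map determines the operation. -/
theorem mem_rep_iff (hn : 1 ≤ n) (hM : M ⊨ saTheory n) {q : unit n M} {a : M} (ha : IsAtom a)
    {p : Function.End (Fin n) × Function.End M} (hp : p ∈ substMonoid M)
    (hq : q.1 = point a p.1) (y : M) : q ∈ rep y ↔ a ≤ p.2 y := by
  refine ⟨?_, fun h => ⟨a, ha, p, hp, hq, h⟩⟩
  rintro ⟨b, hb, p', hp', hq', hle⟩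
  have hpt := fun k => congrFun (hq.symm.trans hq') k
  -- The atom is read off from coordinate `0`, which exists because `1 ≤ n`.
  have hab : a = b := (Prod.ext_iff.1 (hpt ⟨0, hn⟩)).1
  have hpp : p = p' := substMonoid_injOn_fst hM hp hp' (funext fun k => (Prod.ext_iff.1 (hpt k)).2)
  rwa [hab, hpp]

/-- Composing a point with `σ` multiplies its pair by `(σ, s)` on the right, and the second
coordinate of the product applies `s` first. -/
theorem rep_subst (hn : 1 ≤ n) (hM : M ⊨ saTheory n) {σ : Function.End (Fin n)}
    {s : Function.End M} (hσ : (σ, s) ∈ substMonoid M) (y : M) :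
    rep (n := n) (s y) = setSubst (unit n M) σ (rep y) := by
  ext ⟨q, a, ha, p, hp, hq⟩
  have hmem := mul_mem hp hσ
  have hqσ : q ∘ σ = point a (p * (σ, s)).1 := congrArg (· ∘ σ) hq
  rw [mem_rep_iff hn hM ha hp hq]
  constructor
  · intro h
    exact ⟨⟨q ∘ σ, a, ha, _, hmem, hqσ⟩, ⟨a, ha, _, hmem, hqσ, h⟩, rfl⟩
  · rintro ⟨q', hq', e⟩
    exact (mem_rep_iff hn hM ha hmem (e.trans hqσ) y).1 hq'

variable (hmeet : ∀ a b : M, meetOp n a b = a ⊓ b) (hcompl : ∀ a : M, complOp n a = aᶜ)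
include hmeet hcompl

theorem isCompleteHom_of_mem_substMonoid (hM : M ⊨ csaTheory n)
    {p : Function.End (Fin n) × Function.End M} (hp : p ∈ substMonoid M) :
    IsCompleteHom (B := M) p.2 := by
  have hSA : M ⊨ saTheory n := hM.mono fun φ hφ => Or.inl (Or.inl hφ)
  induction hp using Submonoid.closure_induction_left with
  | one => exact isCompleteHom_id
  | mul_left g hg m hm ih =>
    suffices h : IsCompleteHom (B := M) g.2 from h.comp ih
    obtain ⟨i, j, rfl | rfl⟩ := hg
    · by_cases h : i ≠ j
      · have : IsCompleteHom (swapOp M i j h) :=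
          (isBoolHom_swapOp hmeet hcompl hSA i j h).isCompleteHom_of_involutive
            fun a => swapOp_swapOp hSA a i j h
        rwa [← swapHom_of_ne h] at this
      · have : swapHom M i j = id := dif_neg h
        rw [this]
        exact isCompleteHom_id
    · by_cases h : i ≠ j
      · have hf := isBoolHom_replOp hmeet hcompl hSA i j h
        have : IsCompleteHom (replOp M i j h) :=
          hf.isCompleteHom fun X m hm => hf.isLUB_image
            ((realize_psi_iff hmeet hcompl i j h).1
              (hM.realize_of_mem _ (Or.inr ⟨i, j, h, rfl⟩))) hm
        rwa [← replHom_of_ne h] at this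
      · have : replHom M i j = id := dif_neg h
        rw [this]
        exact isCompleteHom_id

theorem rep_inf (hn : 1 ≤ n) (hM : M ⊨ csaTheory n) (y z : M) :
    rep (n := n) (y ⊓ z) = rep y ∩ rep z := by
  have hSA : M ⊨ saTheory n := hM.mono fun φ hφ => Or.inl (Or.inl hφ)
  ext ⟨q, a, ha, p, hp, hq⟩
  rw [Set.mem_inter_iff, mem_rep_iff hn hSA ha hp hq, mem_rep_iff hn hSA ha hp hq,
    mem_rep_iff hn hSA ha hp hq, (isCompleteHom_of_mem_substMonoid hmeet hcompl hM hp).map_inf,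
    le_inf_iff]

theorem rep_compl (hn : 1 ≤ n) (hM : M ⊨ csaTheory n) (y : M) :
    rep (n := n) yᶜ = (rep y)ᶜ := by
  have hSA : M ⊨ saTheory n := hM.mono fun φ hφ => Or.inl (Or.inl hφ)
  ext ⟨q, a, ha, p, hp, hq⟩
  rw [Set.mem_compl_iff, mem_rep_iff hn hSA ha hp hq, mem_rep_iff hn hSA ha hp hq,
    (isCompleteHom_of_mem_substMonoid hmeet hcompl hM hp).map_compl, atom_le_compl_iff ha]

theorem rep_injective (hn : 1 ≤ n) (hM : M ⊨ csaTheory n) :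
    Function.Injective (rep : M → Set (unit n M)) := by
  have hSA : M ⊨ saTheory n := hM.mono fun φ hφ => Or.inl (Or.inl hφ)
  have hat := (realize_atomicity_iff hmeet hcompl).1
    (hM.realize_of_mem _ (Or.inl (Or.inr rfl)))
  have key : ∀ y z : M, rep (n := n) y = rep z → y ≤ z := fun y z h => by
    by_contra hle
    obtain ⟨a, ha, hay⟩ := hat (y ⊓ zᶜ) fun h =>
      hle (disjoint_compl_right_iff.1 (disjoint_iff.2 h))
    have hq : point a (1 : Function.End (Fin n) × Function.End M).1 ∈ unit n M :=
      ⟨a, ha, 1, one_mem _, rfl⟩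
    have hmem := mem_rep_iff hn hSA (q := ⟨_, hq⟩) ha (one_mem _) rfl
    have hz : a ≤ z := (hmem z).1 (h ▸ (hmem y).2 (hay.trans inf_le_left))
    exact (atom_le_compl_iff ha).1 (hay.trans inf_le_right) hz
  exact fun y z h => le_antisymm (key y z h) (key z y h.symm)

/-- The representation as an embedding. -/
def repEmbedding (hn : 1 ≤ n) (hM : M ⊨ csaTheory n) : M ↪[lang n] Set (unit n M) where
  toFun := rep
  inj' := rep_injective hmeet hcompl hn hM
  map_fun' {k} f v := by
    have hSA : M ⊨ saTheory n := hM.mono fun φ hφ => Or.inl (Or.inl hφ)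
    cases f with
    | meet =>
      rw [show v = ![v 0, v 1] from by ext i; fin_cases i <;> rfl]
      exact (congrArg rep (hmeet (v 0) (v 1))).trans (rep_inf hmeet hcompl hn hM (v 0) (v 1))
    | compl =>
      rw [show v = ![v 0] from by ext i; fin_cases i; rfl]
      exact (congrArg rep (hcompl (v 0))).trans (rep_compl hmeet hcompl hn hM (v 0))
    | repl i j h =>
      rw [show v = ![v 0] from by ext i; fin_cases i; rfl]
      exact rep_subst hn hSA (repl_mem_substMonoid h) (v 0)
    | swap i j h =>
      rw [show v = ![v 0] from by ext i; fin_cases i; rfl]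
      exact rep_subst hn hSA (swap_mem_substMonoid h) (v 0)
  map_rel' r := r.elim

theorem isCSA_of_model (hn : 1 ≤ n) (hM : M ⊨ csaTheory n) : IsCSA n M := by
  have hSA : M ⊨ saTheory n := hM.mono fun φ hφ => Or.inl (Or.inl hφ)
  refine ⟨hSA, M × Fin n, unit n M, locallySquare_unit, repEmbedding hmeet hcompl hn hM, ?_⟩
  intro X m hm
  rw [isMeet_iff hmeet] at hm
  change rep m = ⋂ a ∈ X, rep a
  ext ⟨q, a, ha, p, hp, hq⟩
  have hglb := (isCompleteHom_of_mem_substMonoid hmeet hcompl hM hp).isGLB_image X m hm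
  have hmem := mem_rep_iff hn hSA (q := ⟨q, a, ha, p, hp, hq⟩) ha hp hq
  -- As `p.2 m` is the meet of the `p.2 y` for `y ∈ X`, the atom lies below it iff it lies below
  -- each of them.
  rw [hmem, le_isGLB_iff hglb, Set.mem_iInter₂]
  exact Set.forall_mem_image.trans (forall₂_congr fun y _ => (hmem y).symm)

end Representation

/-! ### Finiteness of the axiom system -/

section Finiteness

variable {n : ℕ}

theorem finite_setOf_exists {ι : Sort*} [Finite ι] {β : Type*} {P : ι → β → Prop}
    (h : ∀ i, {b | P i b}.Finite) : {b | ∃ i, P i b}.Finite :=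
  (Set.finite_iUnion h).subset fun _ hb => Set.mem_iUnion.2 hb

/-- The membership argument, given as a constructor of `SAEq`, determines the family `F`; likewise
for triples and quadruples. -/
theorem finite_pairs {T : Set (lang n).Sentence} (F : ∀ i j : Fin n, i ≠ j → (lang n).Sentence)
    (_ : ∀ i j h, F i j h ∈ T) : {φ | ∃ i j h, φ = F i j h}.Finite :=
  finite_setOf_exists fun _ => finite_setOf_exists fun _ => finite_setOf_exists fun _ =>
    Set.finite_singleton _

theorem finite_triples {T : Set (lang n).Sentence}
    (F : ∀ i j k : Fin n, i ≠ j → i ≠ k → j ≠ k → (lang n).Sentence)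
    (_ : ∀ i j k hij hik hjk, F i j k hij hik hjk ∈ T) :
    {φ | ∃ i j k hij hik hjk, φ = F i j k hij hik hjk}.Finite :=
  finite_setOf_exists fun _ => finite_setOf_exists fun _ => finite_setOf_exists fun _ =>
    finite_setOf_exists fun _ => finite_setOf_exists fun _ => finite_setOf_exists fun _ =>
      Set.finite_singleton _

theorem finite_quadruples {T : Set (lang n).Sentence}
    (F : ∀ i j k l : Fin n, i ≠ j → i ≠ k → i ≠ l → j ≠ k → j ≠ l → k ≠ l → (lang n).Sentence)
    (_ : ∀ i j k l hij hik hil hjk hjl hkl, F i j k l hij hik hil hjk hjl hkl ∈ T) :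
    {φ | ∃ i j k l hij hik hil hjk hjl hkl, φ = F i j k l hij hik hil hjk hjl hkl}.Finite :=
  finite_setOf_exists fun _ => finite_setOf_exists fun _ => finite_setOf_exists fun _ =>
    finite_setOf_exists fun _ => finite_setOf_exists fun _ => finite_setOf_exists fun _ =>
      finite_setOf_exists fun _ => finite_setOf_exists fun _ => finite_setOf_exists fun _ =>
        finite_setOf_exists fun _ => Set.finite_singleton _

theorem finite_saTheory : (saTheory n).Finite := by
  have finite_one {φ : (lang n).Sentence} (_ : SAEq n φ) : {ψ | ψ = φ}.Finite :=
    Set.finite_singleton φ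
  have h1 := (finite_one .meet_comm).union <| (finite_one .meet_assoc).union <|
    (finite_one .join_comm).union <| (finite_one .join_assoc).union <|
    (finite_one .absorb_meet).union <| (finite_one .absorb_join).union <|
    (finite_one .distrib).union <| (finite_one .zero_le).union (finite_one .le_one)
  have h2 := (finite_pairs (T := saTheory n) _ .swap_meet).union <|
    (finite_pairs (T := saTheory n) _ .swap_compl).union <|
    (finite_pairs (T := saTheory n) _ .repl_meet).union <|
    (finite_pairs (T := saTheory n) _ .repl_compl).union <|
    (finite_pairs (T := saTheory n) _ .swap_symm).union <|
    (finite_pairs (T := saTheory n) _ .swap_invol).union <|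
    (finite_pairs (T := saTheory n) _ .conj_self).union <|
    (finite_pairs (T := saTheory n) _ .repl_idem).union <|
    (finite_pairs (T := saTheory n) _ .repl_back).union
    (finite_pairs (T := saTheory n) _ .repl_swap)
  have h3 := (finite_triples (T := saTheory n) _ .swap_conj).union <|
    (finite_triples (T := saTheory n) _ .conj_source).union <|
    (finite_triples (T := saTheory n) _ .conj_target).union <|
    (finite_triples (T := saTheory n) _ .repl_same_target).union <|
    (finite_triples (T := saTheory n) _ .repl_chain).union <|
    (finite_triples (T := saTheory n) _ .repl_shift).union
    (finite_triples (T := saTheory n) _ .repl_same_source)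
  have h4 := (finite_quadruples (T := saTheory n) _ .swap_swap).union <|
    (finite_quadruples (T := saTheory n) _ .conj_disjoint).union
    (finite_quadruples (T := saTheory n) _ .repl_disjoint)
  refine (h1.union (h2.union (h3.union h4))).subset fun φ hφ => ?_
  cases hφ
  case meet_comm | meet_assoc | join_comm | join_assoc | absorb_meet | absorb_join | distrib |
      zero_le | le_one =>
    refine Or.inl ?_
    repeat first | exact rfl | exact Or.inl rfl | refine Or.inr ?_
  case swap_meet i j h | swap_compl i j h | repl_meet i j h | repl_compl i j h |
      swap_symm i j h | swap_invol i j h | conj_self i j h | repl_idem i j h |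
      repl_back i j h | repl_swap i j h =>
    refine Or.inr (Or.inl ?_)
    repeat first | exact ⟨i, j, h, rfl⟩ | exact Or.inl ⟨i, j, h, rfl⟩ | refine Or.inr ?_
  case swap_conj i j k a b c | conj_source i j k a b c | conj_target i j k a b c |
      repl_same_target i j k a b c | repl_chain i j k a b c | repl_shift i j k a b c |
      repl_same_source i j k a b c =>
    refine Or.inr (Or.inr (Or.inl ?_))
    repeat first
      | exact ⟨i, j, k, a, b, c, rfl⟩
      | exact Or.inl ⟨i, j, k, a, b, c, rfl⟩
      | refine Or.inr ?_
  case swap_swap i j k l a b c d e f | conj_disjoint i j k l a b c d e f |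
      repl_disjoint i j k l a b c d e f =>
    refine Or.inr (Or.inr (Or.inr ?_))
    repeat first
      | exact ⟨i, j, k, l, a, b, c, d, e, f, rfl⟩
      | exact Or.inl ⟨i, j, k, l, a, b, c, d, e, f, rfl⟩
      | refine Or.inr ?_

theorem finite_csaTheory : (csaTheory n).Finite :=
  (finite_saTheory.union (Set.finite_singleton _)).union
    (finite_pairs (T := Set.univ) psi fun _ _ _ => trivial)

end Finiteness

end SubstAlg

/-! ### The main theorem. -/

theorem mainTheorem2 (n : ℕ) (hn : 1 ≤ n) :
    -- the axiom system is finite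
    (SubstAlg.csaTheory n).Finite ∧
    -- its models are exactly the completely representable algebras
    (∀ (M : Type*) [(SubstAlg.lang n).Structure M] [Nonempty M],
      FirstOrder.Language.Theory.Model M (SubstAlg.csaTheory n) ↔ SubstAlg.IsCSA n M) ∧
    -- in an atomic algebra of `SA_n`, `ψ_{i,j}` says that `s^i_j` is completely additive
    (∀ (M : Type*) [(SubstAlg.lang n).Structure M] [Nonempty M],
      FirstOrder.Language.Theory.Model M (SubstAlg.saTheory n) →
      FirstOrder.Language.Sentence.Realize M (SubstAlg.atomicity (n := n)) →
      ∀ (i j : Fin n) (h : i ≠ j),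
        FirstOrder.Language.Sentence.Realize M (SubstAlg.psi i j h) ↔
          SubstAlg.CompletelyAdditive n (SubstAlg.replOp M i j h)) := by
  refine ⟨SubstAlg.finite_csaTheory, fun M _ _ => ⟨fun hM => ?_, fun hM => ?_⟩,
    fun M _ _ hM hat i j h => ?_⟩
  · let _ := SubstAlg.boolAlg (hM.mono fun φ hφ => Or.inl (Or.inl hφ))
    exact SubstAlg.isCSA_of_model (fun _ _ => rfl) (fun _ => rfl) hn hM
  · let _ := SubstAlg.boolAlg hM.1
    exact SubstAlg.realize_csaTheory (fun _ _ => rfl) (fun _ => rfl) hM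
  · let _ := SubstAlg.boolAlg hM
    exact SubstAlg.realize_psi_iff_completelyAdditive (fun _ _ => rfl) (fun _ => rfl) hM hat i j h
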